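/- Let $k$ be an algebraically closed field, $d\geqslant 1$ an integer, and let $\mathscr T$ be a $k$-linear $\operatorname{Hom}$-finite $(d+2)$-angulated category (in the sense of Geiss–Keller–Oppermann) with split idempotents and $d$-suspension functor $\Sigma^d$. Write $\Sigma^{-d}$ for the inverse of $\Sigma^d$ and $\Sigma^{2d}=(\Sigma^d)^2$. Assume that $\mathscr T$ is $2d$-Calabi–Yau, i.e. $\mathscr T(X,Y)\cong \operatorname{Hom}_k(\mathscr T(Y,\Sigma^{2d}X),k)$ naturally in $X,Y\in\mathscr T$. Put $\operatorname{Ext}^d_{\mathscr T}(X,Y)=\mathscr T(X,\Sigma^dY)$, and let $\operatorname{add}X$ denote the class of direct summands of finite direct sums of copies of $X$. An object $X\in\mathscr T$ is $d$-rigid if $\operatorname{Ext}^d_{\mathscr T}(X,X)=0$, and maximal $d$-rigid if $\operatorname{add}X=\{Y\in\mathscr T\mid \operatorname{Ext}^d_{\mathscr T}(X\oplus Y,X\oplus Y)=0\}$. Let $T\in\mathscr T$ be an Oppermann–Thomas cluster tilting object, i.e. $T$ is $d$-rigid and for every $Y\in\mathscr T$ there is a $(d+2)$-angle $T_d\to\cdots\to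 T_0\to Y\to\Sigma^dT_d$ with all $T_i\in\operatorname{add}T$. Let $\Gamma=\operatorname{End}_{\mathscr T}(T)$, let $\operatorname{mod}\Gamma$ be the category of finitely generated right $\Gamma$-modules, $\operatorname{proj}\Gamma$ its full subcategory of projective modules, $\mathscr D$ the essential image of $\mathscr T(T,-)\colon\mathscr T\to\operatorname{mod}\Gamma$, and $\tau_d=\tau\,\Omega^{d-1}$ the $d$-Auslander–Reiten translation, where $\Omega M$ is the kernel of the projective cover of $M$ and $\tau$ is the Auslander–Reiten translation of $\operatorname{mod}\Gamma$ (defined by minimal projective presentations). A pair $(M,P)$ with $M\in\mathscr D$ and $P\in\operatorname{proj}\Gamma$ is a maximal $\tau_d$-rigid pair in $\mathscr D$ if (i) for every $N\in\mathscr D$: $N\in\operatorname{add}M$ if and only if $\operatorname{Hom}_\Gamma(M,\tau_dN)=0$, $\operatorname{Hom}_\Gamma(N,\tau_dM)=0$ and $\operatorname{Hom}_\Gamma(P,N)=0$; and (ii) for every $Q\in\operatorname{proj}\Gamma$: $Q\in\operatorname{add}P$ if and only if $\operatorname{Hom}_\Gamma(Q,M)=0$. Every $X\in\mathscr T$ has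 a decomposition $X\cong X'\oplus X''$ such that $X'$ has no non-zero direct summand in $\operatorname{add}\Sigma^dT$ and $X''\in\operatorname{add}\Sigma^dT$. If every indecomposable object of $\mathscr T$ is $d$-rigid, then $$X\longmapsto\Delta(X)=\bigl(\mathscr T(T,X'),\ \mathscr T(T,\Sigma^{-d}X'')\bigr)$$ induces a well-defined bijection, independent of the chosen decompositions, from the set of isomorphism classes of maximal $d$-rigid objects of $\mathscr T$ to the set of isomorphism classes of maximal $\tau_d$-rigid pairs in $\mathscr D$. -/

import Mathlib

open CategoryTheory CategoryTheory.Limits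

universe w v u

namespace HigherAngulated

/-! ## Isomorphism classes, additive closures -/

/-- The isomorphism classes of the objects of `C` that have the property `P`. -/
def IsoClasses {C : Type u} [Category.{v} C] (P : ObjectProperty C) : Type u :=
  Quotient (isIsomorphicSetoid P.FullSubcategory)

/-- The isomorphism class of an object `X` with the property `P`. -/
def IsoClasses.mk {C : Type u} [Category.{v} C] (P : ObjectProperty C) (X : C) (hX : P X) :
    IsoClasses P :=
  Quotient.mk (isIsomorphicSetoid P.FullSubcategory) ⟨X, hX⟩

/-- `InAdd X Y`: the object `Y` belongs to `add X`, that is, `Y` is a direct summand of a finite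
direct sum of copies of `X`.  (It is used in categories with split idempotents only, where the
retracts of an object are its direct summands.) -/
def InAdd {C : Type u} [Category.{v} C] [Preadditive C] [HasFiniteBiproducts C] (X Y : C) : Prop :=
  ∃ n : ℕ, Nonempty (Retract Y (⨁ fun _ : Fin n => X))

/-! ## `(d+2)`-angulated categories -/

section Angulated

variable {C : Type u} [Category.{v} C] [Preadditive C]

/-- A `(d+2)`-`S`-sequence
`X_{d+1} ⟶ X_d ⟶ ⋯ ⟶ X_1 ⟶ X_0 ⟶ S X_{d+1}`
for an autoequivalence `S` of `C` (no condition is imposed on the composites). -/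
structure SSeq (d : ℕ) (S : C ≌ C) where
  /-- the objects -/
  obj : Fin (d + 2) → C
  /-- the morphisms `X_{i+1} ⟶ X_i` -/
  map : ∀ i : Fin (d + 1), obj i.succ ⟶ obj i.castSucc
  /-- the last morphism `X_0 ⟶ S X_{d+1}` -/
  conn : obj 0 ⟶ S.functor.obj (obj (Fin.last (d + 1)))

namespace SSeq

variable {d : ℕ} {S : C ≌ C}

/-- A morphism of `(d+2)`-`S`-sequences. -/
@[ext]
structure Hom (A B : SSeq d S) where
  /-- the components -/
  app : ∀ i : Fin (d + 2), A.obj i ⟶ B.obj i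
  comm : ∀ i : Fin (d + 1), A.map i ≫ app i.castSucc = app i.succ ≫ B.map i
  comm_conn : A.conn ≫ S.functor.map (app (Fin.last (d + 1))) = app 0 ≫ B.conn

instance : Category (SSeq d S) where
  Hom := Hom
  id A := ⟨fun _ => 𝟙 _, by simp, by simp⟩
  comp f g := ⟨fun i => f.app i ≫ g.app i,
    fun i => by rw [← Category.assoc, f.comm, Category.assoc, g.comm, Category.assoc],
    by rw [S.functor.map_comp, ← Category.assoc, f.comm_conn, Category.assoc, g.comm_conn,
      Category.assoc]⟩
  id_comp f := Hom.ext (funext fun i => Category.id_comp (f.app i))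
  comp_id f := Hom.ext (funext fun i => Category.comp_id (f.app i))
  assoc f g h := Hom.ext (funext fun i => Category.assoc (f.app i) (g.app i) (h.app i))

/-- `B` is a direct sum of `A₁` and `A₂` in the category of `(d+2)`-`S`-sequences. -/
def IsDirectSum (B A₁ A₂ : SSeq d S) : Prop :=
  ∃ (i₁ : A₁ ⟶ B) (i₂ : A₂ ⟶ B) (p₁ : B ⟶ A₁) (p₂ : B ⟶ A₂),
    i₁ ≫ p₁ = 𝟙 A₁ ∧ i₂ ≫ p₂ = 𝟙 A₂ ∧
      ∀ j, p₁.app j ≫ i₁.app j + p₂.app j ≫ i₂.app j = 𝟙 (B.obj j)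

/-- `A` is isomorphic to a trivial sequence `X ⟶ X ⟶ 0 ⟶ ⋯ ⟶ 0 ⟶ S X` whose first morphism
is the identity. -/
def IsTrivial (A : SSeq d S) : Prop :=
  IsIso (A.map (Fin.last d)) ∧ ∀ i : Fin (d + 2), i.val < d → IsZero (A.obj i)

/-- The left rotation
`X_d ⟶ ⋯ ⟶ X_0 ⟶ S X_{d+1} ⟶ S X_d` of a `(d+2)`-`S`-sequence; its last morphism is
`(-1)^(d+2)` times the image under `S` of the first morphism `X_{d+1} ⟶ X_d`. -/
def rotate (A : SSeq d S) : SSeq d S where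
  obj := Fin.cases (S.functor.obj (A.obj (Fin.last (d + 1)))) fun i => A.obj i.castSucc
  map := Fin.cases A.conn fun j => A.map j.castSucc
  conn := (-1 : ℤ) ^ (d + 2) • S.functor.map (A.map (Fin.last d))

/-- The mapping cone
`X_d ⊞ Y_{d+1} ⟶ X_{d-1} ⊞ Y_d ⟶ ⋯ ⟶ S X_{d+1} ⊞ Y_0 ⟶ S (X_d ⊞ Y_{d+1})`
of a morphism `φ : X ⟶ Y` of `(d+2)`-`S`-sequences, with the morphisms
`(-α, 0; φ, β)` where `α` and `β` are those of `X` and `Y`. -/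
noncomputable def cone [HasBinaryBiproducts C] {A B : SSeq d S} (φ : A ⟶ B) : SSeq d S where
  obj i := A.rotate.obj i ⊞ B.obj i
  map i := biprod.desc (biprod.lift (-A.rotate.map i) (φ.app i.castSucc)) (B.map i ≫ biprod.inr)
  conn := biprod.desc
    (S.functor.map (biprod.lift (-A.map (Fin.last d)) (φ.app (Fin.last (d + 1)))))
    (B.conn ≫ S.functor.map biprod.inr)

end SSeq

/-- A `(d+2)`-angulation of the additive category `C` with `d`-suspension functor `S`
(axioms of Geiss, Keller and Oppermann): a class of `(d+2)`-`S`-sequences, the `(d+2)`-angles,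
subject to the axioms below. -/
structure Angulation [HasBinaryBiproducts C] (d : ℕ) (S : C ≌ C) where
  /-- the class of `(d+2)`-angles -/
  IsAngle : SSeq d S → Prop
  of_iso : ∀ {A B : SSeq d S}, (A ≅ B) → IsAngle A → IsAngle B
  directSum : ∀ {B A₁ A₂ : SSeq d S}, B.IsDirectSum A₁ A₂ → IsAngle A₁ → IsAngle A₂ → IsAngle B
  directSummand : ∀ {B A₁ A₂ : SSeq d S}, B.IsDirectSum A₁ A₂ → IsAngle B → IsAngle A₁
  trivial : ∀ {A : SSeq d S}, A.IsTrivial → IsAngle A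
  /-- every morphism is, up to isomorphism, the first morphism of a `(d+2)`-angle -/
  exists_angle : ∀ {X Y : C} (f : X ⟶ Y), ∃ A : SSeq d S, IsAngle A ∧
    ∃ (e₁ : A.obj (Fin.last d).succ ≅ X) (e₂ : A.obj (Fin.last d).castSucc ≅ Y),
      A.map (Fin.last d) ≫ e₂.hom = e₁.hom ≫ f
  rotate_iff : ∀ A : SSeq d S, IsAngle A ↔ IsAngle A.rotate
  /-- a commutative square between the first morphisms of two `(d+2)`-angles extends to a
  morphism of `(d+2)`-angles, which can be chosen such that its mapping cone is a
  `(d+2)`-angle -/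
  exists_hom : ∀ {A B : SSeq d S}, IsAngle A → IsAngle B →
    ∀ (a : A.obj (Fin.last d).succ ⟶ B.obj (Fin.last d).succ)
      (b : A.obj (Fin.last d).castSucc ⟶ B.obj (Fin.last d).castSucc),
      A.map (Fin.last d) ≫ b = a ≫ B.map (Fin.last d) →
      ∃ φ : A ⟶ B, φ.app (Fin.last d).succ = a ∧ φ.app (Fin.last d).castSucc = b ∧
        IsAngle (SSeq.cone φ)

/-- `C` is `2d`-Calabi–Yau with respect to its `d`-suspension functor `S`: there are `k`-linear
isomorphisms `C(X, Y) ≅ D C(Y, S² X)`, natural in `X` and `Y`. -/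
structure CalabiYau (k : Type w) [Field k] [Linear k C] (S : C ≌ C) where
  /-- the isomorphisms -/
  equiv : ∀ X Y : C,
    (X ⟶ Y) ≃ₗ[k] Module.Dual k (Y ⟶ S.functor.obj (S.functor.obj X))
  naturality : ∀ {X X' Y Y' : C} (f : X' ⟶ X) (h : X ⟶ Y) (g : Y ⟶ Y')
    (t : Y' ⟶ S.functor.obj (S.functor.obj X')),
    equiv X' Y' (f ≫ h ≫ g) t =
      equiv X Y h (g ≫ t ≫ S.functor.map (S.functor.map f))

/-- `Ext^d(X, Y) = C(X, S Y)` is zero. -/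
def ExtVanishes (S : C ≌ C) (X Y : C) : Prop :=
  ∀ f : X ⟶ S.functor.obj Y, f = 0

/-- `X` is `d`-rigid. -/
def IsRigid (S : C ≌ C) (X : C) : Prop :=
  ExtVanishes S X X

/-- `X` is maximal `d`-rigid. -/
def IsMaximalRigid [HasBinaryBiproducts C] [HasFiniteBiproducts C] (S : C ≌ C) :
    ObjectProperty C :=
  fun X => ∀ Y : C, InAdd X Y ↔ ExtVanishes S (X ⊞ Y) (X ⊞ Y)

/-- `T` is an Oppermann–Thomas cluster tilting object: it is `d`-rigid, and every `Y` lies in a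
`(d+2)`-angle `T_d ⟶ ⋯ ⟶ T_0 ⟶ Y ⟶ S T_d` with all `T_i` in `add T`. -/
def Angulation.IsClusterTilting [HasBinaryBiproducts C] [HasFiniteBiproducts C]
    {d : ℕ} {S : C ≌ C} (𝒜 : Angulation d S) (T : C) : Prop :=
  IsRigid S T ∧ ∀ Y : C, ∃ A : SSeq d S, 𝒜.IsAngle A ∧ Nonempty (A.obj 0 ≅ Y) ∧
    ∀ i : Fin (d + 1), InAdd T (A.obj i.succ)

/-- `X ≅ X' ⊞ X''` where `X'` has no non-zero direct summand in `add (S T)` and `X''` is in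
`add (S T)`. -/
structure IsDecomposition [HasBinaryBiproducts C] [HasFiniteBiproducts C] (S : C ≌ C)
    (T X X' X'' : C) : Prop where
  iso : Nonempty (X ≅ X' ⊞ X'')
  no_summand : ∀ Z : C, InAdd (S.functor.obj T) Z → Nonempty (Retract Z X') → IsZero Z
  mem_add : InAdd (S.functor.obj T) X''

end Angulated

/-! ## The `d`-Auslander–Reiten translation over a finite-dimensional algebra -/

section Tau

variable {R : Type v} [Ring R]

/-- A projective cover of the module `M`: an epimorphism from a projective module whose kernel is
superfluous. -/
structure ProjCover (M : ModuleCat.{v} R) where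
  /-- the projective module -/
  P : ModuleCat.{v} R
  /-- the epimorphism -/
  π : P →ₗ[R] M
  projective : Module.Projective R P
  finite : Module.Finite R P
  surjective : Function.Surjective π
  superfluous : ∀ N : Submodule R P, N ⊔ LinearMap.ker π = ⊤ → N = ⊤

/-- Finitely generated modules over Artinian rings have projective covers. -/
theorem nonempty_projCover [IsArtinianRing R] (M : ModuleCat.{v} R) [Module.Finite R M] :
    Nonempty (ProjCover M) := by
  classical
  obtain ⟨n, f, hf⟩ := Module.Finite.exists_fin' R M
  let F : Set (Submodule R (Fin n → R)) :=
    {Q | (∃ Q', IsCompl Q Q') ∧ Q.map f = ⊤}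
  have hF : F.Nonempty := ⟨⊤, ⟨⊥, isCompl_top_bot⟩, by
    rw [Submodule.map_top, LinearMap.range_eq_top.2 hf]⟩
  obtain ⟨Q, ⟨⟨Q', hQ'⟩, hQf⟩, hmin⟩ := WellFounded.has_min
    (wellFounded_lt : WellFounded (α := Submodule R (Fin n → R)) (· < ·)) F hF
  have hproj : Module.Projective R Q :=
    Module.Projective.of_split Q.subtype (Q.projectionOnto Q' hQ') (by
      ext x; simp)
  have hsurj : Function.Surjective (f ∘ₗ Q.subtype) := by
    rw [← LinearMap.range_eq_top, LinearMap.range_comp, Submodule.range_subtype, hQf]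
  refine ⟨⟨ModuleCat.of R Q, f ∘ₗ Q.subtype, hproj, inferInstanceAs (Module.Finite R Q),
    hsurj, ?_⟩⟩
  intro N hN
  change Submodule R Q at N
  have hNs : Function.Surjective ((f ∘ₗ Q.subtype) ∘ₗ N.subtype) := by
    rw [← LinearMap.range_eq_top, LinearMap.range_comp, Submodule.range_subtype]
    have := congrArg (Submodule.map (f ∘ₗ Q.subtype)) hN
    rw [Submodule.map_sup, Submodule.map_top, LinearMap.range_eq_top.2 hsurj] at this
    rw [← this]
    refine (sup_eq_left.2 ?_).symm
    rintro _ ⟨x, hx, rfl⟩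
    rw [LinearMap.mem_ker.1 hx]
    exact zero_mem _
  obtain ⟨g, hg⟩ := Module.projective_lifting_property _ (f ∘ₗ Q.subtype) hNs
  let e : Module.End R Q := N.subtype ∘ₗ g
  have he : (f ∘ₗ Q.subtype) ∘ₗ e = f ∘ₗ Q.subtype := hg
  have hen : ∀ m : ℕ, (f ∘ₗ Q.subtype) ∘ₗ (e ^ m) = f ∘ₗ Q.subtype := by
    intro m
    induction m with
    | zero => rfl
    | succ m ih => rw [pow_succ', Module.End.mul_eq_comp, ← LinearMap.comp_assoc, he, ih]
  obtain ⟨m, hm, hm1⟩ := (e.eventually_isCompl_ker_pow_range_pow.and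
    (Filter.eventually_ge_atTop 1)).exists
  have hle : LinearMap.range (e ^ m) ≤ N := by
    obtain ⟨j, rfl⟩ := Nat.exists_eq_add_of_le' hm1
    rintro _ ⟨x, rfl⟩
    rw [pow_succ', Module.End.mul_apply]
    exact (g ((e ^ j) x)).2
  have hmem : (LinearMap.range (e ^ m)).map Q.subtype ∈ F := by
    refine ⟨⟨(LinearMap.ker (e ^ m)).map Q.subtype ⊔ Q', ?_, ?_⟩, ?_⟩
    · rw [Submodule.disjoint_def]
      rintro _ ⟨x, hx, rfl⟩ h2
      obtain ⟨_, ⟨y, hy, rfl⟩, z, hz, hyz⟩ := Submodule.mem_sup.1 h2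
      have hz' : z = ((x - y : Q) : Fin n → R) := by
        rw [Submodule.coe_sub, eq_sub_iff_add_eq, add_comm]; exact hyz
      have h0 : z = 0 := Submodule.disjoint_def.1 hQ'.disjoint z (by rw [hz']; exact (x - y).2) hz
      have hxy : x = y := by
        rw [h0] at hz'
        exact sub_eq_zero.1 (Subtype.ext hz'.symm)
      have : x = 0 := Submodule.disjoint_def.1 hm.disjoint x (hxy ▸ hy) hx
      rw [this]; rfl
    · rw [codisjoint_iff, ← sup_assoc, ← Submodule.map_sup, sup_comm (LinearMap.range _),
        hm.sup_eq_top, Submodule.map_top, Submodule.range_subtype, hQ'.sup_eq_top]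
    · rw [← Submodule.map_comp, ← LinearMap.range_comp, hen, LinearMap.range_eq_top.2 hsurj]
  have heq : (LinearMap.range (e ^ m)).map Q.subtype = Q :=
    (Submodule.map_subtype_le _ _).eq_of_not_lt (hmin _ hmem)
  refine top_unique (le_trans ?_ hle)
  intro x _
  have hx : (x : Fin n → R) ∈ (LinearMap.range (e ^ m)).map Q.subtype := by
    rw [heq]; exact x.2
  obtain ⟨y, hy, hyx⟩ := hx
  rwa [← Subtype.ext hyx]

/-- The projective cover of a finitely generated module over an Artinian ring. -/
noncomputable def projCover [IsArtinianRing R] (M : ModuleCat.{v} R) [Module.Finite R M] :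
    ProjCover M :=
  (nonempty_projCover M).some

/-- The syzygy `Ω M`, the kernel of the projective cover of `M`. -/
noncomputable def syzygy [IsArtinianRing R] (M : ModuleCat.{v} R) [Module.Finite R M] :
    ModuleCat.{v} R :=
  ModuleCat.of R (LinearMap.ker (projCover M).π)

instance [IsArtinianRing R] (M : ModuleCat.{v} R) [Module.Finite R M] :
    Module.Finite R (syzygy M) :=
  haveI := (projCover M).finite
  inferInstanceAs (Module.Finite R (LinearMap.ker (projCover M).π))

/-- The iterated syzygy `Ω^n M`, as a finitely generated module. -/
noncomputable def iterSyzygy [IsArtinianRing R] (n : ℕ) (M : ModuleCat.{v} R)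
    [hM : Module.Finite R M] : {N : ModuleCat.{v} R // Module.Finite R N} :=
  (fun N : {N : ModuleCat.{v} R // Module.Finite R N} =>
    haveI := N.2
    ⟨syzygy N.1, inferInstance⟩)^[n] ⟨M, hM⟩

variable (k : Type w) [Field k] [Algebra k R]

/-- The module `ν M = D Hom_R(M, R)`, where `D = Hom_k(-, k)`. -/
def Nakayama (M : Type v) [AddCommGroup M] [Module R M] : Type (max v w) :=
  Module.Dual k (M →ₗ[R] R)

noncomputable instance (M : Type v) [AddCommGroup M] [Module R M] :
    AddCommGroup (Nakayama (R := R) k M) :=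
  inferInstanceAs (AddCommGroup (Module.Dual k (M →ₗ[R] R)))

/-- Right multiplication `h ↦ h(-) r` on `Hom_R(M, R)`. -/
def mulRight (M : Type v) [AddCommGroup M] [Module R M] (r : R) :
    (M →ₗ[R] R) →ₗ[k] (M →ₗ[R] R) where
  toFun h := { toFun := fun x => h x * r
               map_add' := fun x y => by rw [map_add, add_mul]
               map_smul' := fun s x => by simp [mul_assoc] }
  map_add' h h' := by ext x; simp [add_mul]
  map_smul' c h := by ext x; simp

/-- The action of `R` on `ν M` is `(r • φ)(h) = φ(h r)`. -/
noncomputable instance (M : Type v) [AddCommGroup M] [Module R M] :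
    Module R (Nakayama (R := R) k M) where
  smul r φ := LinearMap.comp (show Module.Dual k (M →ₗ[R] R) from φ) (mulRight k M r)
  one_smul φ := LinearMap.ext fun h =>
    congrArg (show Module.Dual k (M →ₗ[R] R) from φ) (by ext x; exact mul_one _)
  mul_smul r s φ := LinearMap.ext fun h =>
    congrArg (show Module.Dual k (M →ₗ[R] R) from φ) (by ext x; exact (mul_assoc _ _ _).symm)
  smul_zero r := rfl
  smul_add r φ ψ := rfl
  add_smul r s φ := LinearMap.ext fun h =>
    (congrArg (show Module.Dual k (M →ₗ[R] R) from φ) (by ext x; exact mul_add _ _ _)).trans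
      (map_add (show Module.Dual k (M →ₗ[R] R) from φ) (mulRight k M r h) (mulRight k M s h))
  zero_smul φ := LinearMap.ext fun h =>
    (congrArg (show Module.Dual k (M →ₗ[R] R) from φ) (by ext x; exact mul_zero _)).trans
      (map_zero (show Module.Dual k (M →ₗ[R] R) from φ))

/-- The map `h ↦ h ∘ g` from `Hom_R(N, R)` to `Hom_R(M, R)` induced by `g : M ⟶ N`. -/
def precomp {M N : Type v} [AddCommGroup M] [Module R M] [AddCommGroup N] [Module R N]
    (g : M →ₗ[R] N) : (N →ₗ[R] R) →ₗ[k] (M →ₗ[R] R) where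
  toFun h := h ∘ₗ g
  map_add' _ _ := rfl
  map_smul' _ _ := rfl

/-- The map `ν g : ν M ⟶ ν N`, `(ν g)(φ)(h) = φ(h ∘ g)`, induced by `g : M ⟶ N`. -/
noncomputable def nakayamaMap {M N : Type v} [AddCommGroup M] [Module R M] [AddCommGroup N]
    [Module R N] (g : M →ₗ[R] N) : Nakayama (R := R) k M →ₗ[R] Nakayama (R := R) k N where
  toFun φ := LinearMap.comp (show Module.Dual k (M →ₗ[R] R) from φ) (precomp k g)
  map_add' _ _ := rfl
  map_smul' _ _ := rfl

/-- The map `P(Ω M) ⟶ P(M)` of a minimal projective presentation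
`P(Ω M) ⟶ P(M) ⟶ M ⟶ 0` of `M`. -/
noncomputable def minPresentation [IsArtinianRing R] (M : ModuleCat.{v} R) [Module.Finite R M] :
    (projCover (syzygy M)).P →ₗ[R] (projCover M).P :=
  (LinearMap.ker (projCover M).π).subtype ∘ₗ (projCover (syzygy M)).π

/-- The Auslander–Reiten translate `τ M`, the kernel of `ν P(Ω M) ⟶ ν P(M)`, of a finitely
generated module. -/
noncomputable def tauOne [IsArtinianRing R] (M : ModuleCat.{v} R) [Module.Finite R M] :
    Submodule R (Nakayama (R := R) k (projCover (syzygy M)).P) :=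
  LinearMap.ker (nakayamaMap k (minPresentation M))

/-- The ring underlying a finite-dimensional algebra is Artinian. -/
theorem isArtinianRing_of_finite [Module.Finite k R] : IsArtinianRing R :=
  IsArtinianRing.of_finite k R

/-- The `d`-Auslander–Reiten translate `τ_d M = τ Ω^{d-1} M`, for `d ≥ 1`, of a finitely generated
module `M` over a finite-dimensional algebra. -/
noncomputable def Tau [Module.Finite k R] (d : ℕ) (M : ModuleCat.{v} R) [Module.Finite R M] :
    ModuleCat.{max v w} R :=
  haveI := isArtinianRing_of_finite (R := R) k
  haveI := (iterSyzygy (d - 1) M).2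
  ModuleCat.of R (tauOne k (iterSyzygy (d - 1) M).1)

/-- `Hom_R(M, τ_d N) = 0`. -/
def HomTauVanishes [Module.Finite k R] (d : ℕ) (M N : ModuleCat.{v} R) [Module.Finite R N] :
    Prop :=
  ∀ f : M →ₗ[R] Tau k d N, f = 0

end Tau

/-! ## Maximal `τ_d`-rigid pairs

Right modules over `Γ = End T` are left modules over the opposite ring `(End T)ᵐᵒᵖ`. -/

section Pairs

variable {C : Type u} [Category.{v} C] [Preadditive C]

/-- `𝒟`, the essential image of the functor `C(T, -)` to right `End T`-modules. -/
def EssIm (T : C) : ObjectProperty (ModuleCat.{v} (End T)ᵐᵒᵖ) :=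
  (preadditiveCoyonedaObj T).essImage

/-- `proj Γ`, the finitely generated projective modules. -/
def IsFgProj {R : Type v} [Ring R] : ObjectProperty (ModuleCat.{v} R) :=
  fun P => Module.Finite R P ∧ Module.Projective R P

instance finite_end_op (k : Type w) [Field k] [Linear k C] [∀ X Y : C, Module.Finite k (X ⟶ Y)]
    (T : C) : Module.Finite k (End T)ᵐᵒᵖ :=
  haveI : Module.Finite k (End T) := inferInstanceAs (Module.Finite k (T ⟶ T))
  Module.Finite.equiv (MulOpposite.opLinearEquiv k)

/-- The modules in `𝒟` are finitely generated. -/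
theorem EssIm.finite (k : Type w) [Field k] [Linear k C] [∀ X Y : C, Module.Finite k (X ⟶ Y)]
    {T : C} {M : ModuleCat.{v} (End T)ᵐᵒᵖ} (hM : EssIm T M) : Module.Finite (End T)ᵐᵒᵖ M := by
  obtain ⟨X, ⟨e⟩⟩ := hM
  have hX : Module.Finite (End T)ᵐᵒᵖ ((preadditiveCoyonedaObj T).obj X) := by
    obtain ⟨s, hs⟩ := (inferInstance : Module.Finite k (T ⟶ X)).fg_top
    refine ⟨⟨s, top_unique fun x _ => ?_⟩⟩
    change T ⟶ X at x
    have hx : x ∈ Submodule.span k (s : Set (T ⟶ X)) := by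
      rw [hs]; trivial
    induction hx using Submodule.span_induction with
    | mem y hy => exact Submodule.subset_span hy
    | zero => exact zero_mem _
    | add y z _ _ hy hz => exact add_mem (hy trivial) (hz trivial)
    | smul c y _ hy =>
      have h : c • y = (c • 𝟙 T) ≫ y := by simp
      rw [h]
      let a : End T := c • 𝟙 T
      exact Submodule.smul_mem (R := (End T)ᵐᵒᵖ) _ (MulOpposite.op a) (hy trivial)
  exact Module.Finite.equiv e.toLinearEquiv

/-- A pair `(M, P)` with `M ∈ 𝒟` and `P ∈ proj Γ` is a maximal `τ_d`-rigid pair in `𝒟` if it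
satisfies the following two conditions. -/
structure IsMaximalTauRigidPair (k : Type w) [Field k] [Linear k C]
    [∀ X Y : C, Module.Finite k (X ⟶ Y)] (d : ℕ) (T : C) (M P : ModuleCat.{v} (End T)ᵐᵒᵖ) :
    Prop where
  mem : EssIm T M
  proj : IsFgProj P
  inAdd_iff : ∀ (N : ModuleCat.{v} (End T)ᵐᵒᵖ) (hN : EssIm T N),
    InAdd M N ↔
      (haveI := hN.finite k; HomTauVanishes k d M N) ∧
      (haveI := mem.finite k; HomTauVanishes k d N M) ∧
      ∀ f : P ⟶ N, f = 0
  inAdd_proj_iff : ∀ Q : ModuleCat.{v} (End T)ᵐᵒᵖ, IsFgProj Q →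
    (InAdd P Q ↔ ∀ f : Q ⟶ M, f = 0)

/-- The maximal `τ_d`-rigid pairs in `𝒟`, as a property of the pairs of modules (an isomorphism of
pairs being a pair of isomorphisms). -/
def MaximalTauRigidPairs (k : Type w) [Field k] [Linear k C]
    [∀ X Y : C, Module.Finite k (X ⟶ Y)] (d : ℕ) (T : C) :
    ObjectProperty (ModuleCat.{v} (End T)ᵐᵒᵖ × ModuleCat.{v} (End T)ᵐᵒᵖ) :=
  fun MP => IsMaximalTauRigidPair k d T MP.1 MP.2

end Pairs

end HigherAngulated

namespace HigherAngulated

/-! ## Nilpotent elements of finite-dimensional algebras -/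

/-! Write `S` for the `d`-suspension and `F` for `C(T, -)`. The proof translates both notions of
maximality into statements about `Ext^d` in `C` and then compares them summand by summand.

The angle `T_d ⟶ ⋯ ⟶ T_0 ⟶ Y ⟶ S T_d` makes `F` full, with kernel the morphisms factoring through
`add (S T)` (`exists_coyoneda_map_eq`, `exists_factor`). In a `Hom`-finite category with split
idempotents, an endomorphism of `X` factoring through an object that shares no non-zero summand with
`X` is nilpotent (`isIso_one_sub_of_factors`). Hence objects without summands in `add (S T)` are
determined by their images under `F`, and membership in `add` is detected there. On `add T` the
functor is an equivalence onto `proj Γ`. So a pair `(M, P)` is the same thing as an object `X' ⊞ S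
B`, with `X'` free of summands in `add (S T)` and `B` in `add T`.

Applying `F` to the angle gives a projective resolution of `F Y` up to degree `d`. If `Y` has no
summand in `add (S T)`, its last map `F T_d ⟶ F T_{d-1}` has no superfluous summand in its source,
so it computes `τ_d`: `Hom(F X, τ_d F Y) = 0` if and only if every `T_d ⟶ X` factors through `T_d ⟶
T_{d-1}`, that is, every composite `Y ⟶ W ⟶ S X` with `W` in `add (S T)` is zero
(`homTauVanishes_iff`). By Calabi–Yau duality, the vanishing of these composites for `(X, Y)` and
for `(Y, X)` together amounts to `Ext^d(X, Y) = 0` (`extVanishes_iff`).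

Since indecomposables are rigid and `Ext^d` vanishing is symmetric, `X` is maximal `d`-rigid exactly
when `add X` is the class of all `Y` with `Ext^d(X, Y) = 0` (`CalabiYau.isMaximalRigid_iff`).
Splitting `Y` as `Y' ⊞ S A` turns this condition into the two conditions on the pair: `Y'` gives (i)
and `S A` gives (ii) (`isMaximalTauRigidPair_iff`). -/

theorem isNilpotent_of_forall_idempotent {k E : Type*} [Field k] [Ring E] [Algebra k E]
    [Module.Finite k E] (a : E)
    (h : ∀ b, Commute a b → IsIdempotentElem (a * b) → a * b = 0) : IsNilpotent a := by
  have hp : minpoly k a ≠ 0 := minpoly.ne_zero (Algebra.IsIntegral.isIntegral a)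
  obtain ⟨q, hq, hXq⟩ :=
    Polynomial.exists_eq_pow_rootMultiplicity_mul_and_not_dvd (minpoly k a) hp 0
  rw [Polynomial.C_0, sub_zero] at hq hXq
  set n := (minpoly k a).rootMultiplicity 0
  -- The minimal polynomial is `X^n q` with `X ∤ q`, and `s X^(n+1) + t q = 1`. Then `s X^(n+1)`
  -- evaluates to a Fitting idempotent. The exponent `n + 1` makes it a multiple of `a` even when `n
  -- = 0`.
  have hcop : IsCoprime (Polynomial.X ^ (n + 1)) q :=
    ((Polynomial.irreducible_X (R := k)).coprime_iff_not_dvd.2 hXq).pow_left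
  obtain ⟨s, t, hst⟩ := hcop
  have h0 : Polynomial.aeval a (Polynomial.X ^ n * q) = 0 := by rw [← hq, minpoly.aeval]
  have hab : a * Polynomial.aeval a (Polynomial.X ^ n * s) =
      Polynomial.aeval a (s * Polynomial.X ^ (n + 1)) := by
    conv_lhs => rw [← Polynomial.aeval_X (R := k) a]
    rw [Polynomial.aeval_X, ← Polynomial.aeval_X (R := k) a, Polynomial.aeval_X, pow_succ]
    rw [show s * (Polynomial.X ^ n * Polynomial.X) = Polynomial.X * (Polynomial.X ^ n * s) by ring,
      map_mul (Polynomial.aeval a) Polynomial.X, Polynomial.aeval_X]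
  have hz := h (Polynomial.aeval a (Polynomial.X ^ n * s))
    (by
      have := Polynomial.aeval_X (R := k) a
      rw [Commute, SemiconjBy]
      nth_rw 1 [← this]
      nth_rw 4 [← this]
      rw [← map_mul, ← map_mul, mul_comm])
    (by
      rw [IsIdempotentElem, hab, ← map_mul]
      have : s * Polynomial.X ^ (n + 1) * (s * Polynomial.X ^ (n + 1)) =
          s * Polynomial.X ^ (n + 1) - (s * t * Polynomial.X) * (Polynomial.X ^ n * q) := by
        linear_combination (s * Polynomial.X ^ (n + 1)) * hst
      rw [this, map_sub, map_mul _ _ (Polynomial.X ^ n * q), h0, mul_zero, sub_zero])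
  rw [hab] at hz
  refine ⟨n, ?_⟩
  have : (Polynomial.X ^ n : Polynomial k) =
      Polynomial.X ^ n * (s * Polynomial.X ^ (n + 1)) + t * (Polynomial.X ^ n * q) := by
    linear_combination (-Polynomial.X ^ n) * hst
  have h2 := congrArg (Polynomial.aeval a) this
  rwa [map_add, map_mul, hz, map_mul, h0, mul_zero, mul_zero, add_zero, map_pow,
    Polynomial.aeval_X] at h2

/-! ## Additive closures -/

section Add

variable {C : Type u} [Category.{v} C] [Preadditive C]

theorem inAdd_iff [HasFiniteBiproducts C] {X Y : C} :
    InAdd X Y ↔ ∃ (n : ℕ) (u : Fin n → (Y ⟶ X)) (v : Fin n → (X ⟶ Y)),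
      ∑ j, u j ≫ v j = 𝟙 Y := by
  constructor
  · rintro ⟨n, ⟨r⟩⟩
    refine ⟨n, fun j => r.i ≫ biproduct.π _ j, fun j => biproduct.ι (fun _ : Fin n => X) j ≫ r.r, ?_⟩
    simp only [Category.assoc]
    rw [← r.retract, ← Preadditive.comp_sum]
    congr 1
    simp only [← Category.assoc]
    rw [← Preadditive.sum_comp, biproduct.total, Category.id_comp]
  · rintro ⟨n, u, v, h⟩
    exact ⟨n, ⟨⟨biproduct.lift u, biproduct.desc v, by rw [biproduct.lift_desc, h]⟩⟩⟩

variable [HasFiniteBiproducts C]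

theorem inAdd_of_finset {ι : Type*} [Fintype ι] {X Y : C} (u : ι → (Y ⟶ X)) (v : ι → (X ⟶ Y))
    (h : ∑ j, u j ≫ v j = 𝟙 Y) : InAdd X Y := by
  refine inAdd_iff.2 ⟨Fintype.card ι, fun j => u ((Fintype.equivFin ι).symm j),
    fun j => v ((Fintype.equivFin ι).symm j), ?_⟩
  rw [← h]
  exact Equiv.sum_comp (Fintype.equivFin ι).symm fun j => u j ≫ v j

theorem InAdd.refl (X : C) : InAdd X X :=
  inAdd_of_finset (ι := Unit) (fun _ => 𝟙 X) (fun _ => 𝟙 X) (by simp)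

theorem InAdd.of_isZero (X : C) {Y : C} (h : IsZero Y) : InAdd X Y :=
  inAdd_iff.2 ⟨0, fun _ => 0, fun _ => 0, h.eq_of_src _ _⟩

theorem InAdd.of_retract {X Y Z : C} (h : InAdd X Y) (r : Retract Z Y) : InAdd X Z := by
  obtain ⟨n, ⟨s⟩⟩ := h
  exact ⟨n, ⟨r.trans s⟩⟩

theorem InAdd.trans {X Y Z : C} (h : InAdd X Y) (h' : InAdd Y Z) : InAdd X Z := by
  obtain ⟨n, u, v, h⟩ := inAdd_iff.1 h
  obtain ⟨m, u', v', h'⟩ := inAdd_iff.1 h'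
  refine inAdd_of_finset (ι := Fin m × Fin n) (fun p => u' p.1 ≫ u p.2) (fun p => v p.2 ≫ v' p.1) ?_
  rw [Fintype.sum_prod_type, ← h']
  refine Finset.sum_congr rfl fun i _ => ?_
  rw [← Category.comp_id (u' i), ← h, Preadditive.comp_sum, Preadditive.sum_comp]
  simp

theorem InAdd.of_left_retract {X X' Y : C} (h : InAdd X Y) (r : Retract X X') : InAdd X' Y :=
  InAdd.trans ((InAdd.refl X').of_retract r) h

theorem InAdd.map {D : Type*} [Category.{v} D] [Preadditive D] [HasFiniteBiproducts D]
    (F : C ⥤ D) [F.Additive] {X Y : C} (h : InAdd X Y) : InAdd (F.obj X) (F.obj Y) := by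
  obtain ⟨n, u, v, h⟩ := inAdd_iff.1 h
  refine inAdd_iff.2 ⟨n, fun j => F.map (u j), fun j => F.map (v j), ?_⟩
  rw [← F.map_id, ← h, F.map_sum]
  simp

variable [HasBinaryBiproducts C]

theorem InAdd.biprod {X Y Z : C} (h : InAdd X Y) (h' : InAdd X Z) : InAdd X (Y ⊞ Z) := by
  obtain ⟨n, u, v, h⟩ := inAdd_iff.1 h
  obtain ⟨m, u', v', h'⟩ := inAdd_iff.1 h'
  refine inAdd_of_finset (ι := Fin n ⊕ Fin m)
    (Sum.elim (fun i => biprod.fst ≫ u i) (fun i => biprod.snd ≫ u' i))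
    (Sum.elim (fun i => v i ≫ biprod.inl) (fun i => v' i ≫ biprod.inr)) ?_
  rw [Fintype.sum_sum_type]
  simp only [Sum.elim_inl, Sum.elim_inr, Category.assoc]
  have h1 : ∑ i, (biprod.fst : Y ⊞ Z ⟶ Y) ≫ u i ≫ v i ≫ biprod.inl =
      biprod.fst ≫ (biprod.inl : Y ⟶ Y ⊞ Z) := by
    rw [← Preadditive.comp_sum]
    have (i : Fin n) : (u i ≫ v i ≫ biprod.inl : Y ⟶ Y ⊞ Z) = (u i ≫ v i) ≫ biprod.inl :=
      (Category.assoc _ _ _).symm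
    simp only [this]
    rw [← Preadditive.sum_comp, h, Category.id_comp]
  have h2 : ∑ i, (biprod.snd : Y ⊞ Z ⟶ Z) ≫ u' i ≫ v' i ≫ biprod.inr =
      biprod.snd ≫ (biprod.inr : Z ⟶ Y ⊞ Z) := by
    have (i : Fin m) : (u' i ≫ v' i ≫ biprod.inr : Z ⟶ Y ⊞ Z) = (u' i ≫ v' i) ≫ biprod.inr :=
      (Category.assoc _ _ _).symm
    rw [← Preadditive.comp_sum]
    simp only [this]
    rw [← Preadditive.sum_comp, h', Category.id_comp]
  rw [h1, h2, biprod.total]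

/-- The first summand as a retract of a biproduct. -/
noncomputable def retractInl (X Y : C) : Retract X (X ⊞ Y) := ⟨biprod.inl, biprod.fst, by simp⟩

/-- The second summand as a retract of a biproduct. -/
noncomputable def retractInr (X Y : C) : Retract Y (X ⊞ Y) := ⟨biprod.inr, biprod.snd, by simp⟩

theorem inAdd_biprod_iff {X Y Z : C} : InAdd X (Y ⊞ Z) ↔ InAdd X Y ∧ InAdd X Z :=
  ⟨fun h => ⟨h.of_retract (retractInl Y Z), h.of_retract (retractInr Y Z)⟩,
    fun h => h.1.biprod h.2⟩

end Add

/-! ## Endomorphisms and decompositions in `Hom`-finite categories -/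

section HomFinite

variable {C : Type u} [Category.{v} C] [Preadditive C]

/-- If `Z` is the only common retract of `X` and `W` up to zero, the endomorphisms of `X` factoring
through `W` lie in the radical. -/
theorem isIso_one_sub_of_factors (k : Type w) [Field k] [Linear k C]
    [∀ X Y : C, Module.Finite k (X ⟶ Y)] [IsIdempotentComplete C] {X W : C}
    (h : ∀ Z : C, Nonempty (Retract Z X) → Nonempty (Retract Z W) → IsZero Z)
    (p : X ⟶ W) (q : W ⟶ X) : IsIso (𝟙 X - p ≫ q) := by
  let a : End X := p ≫ q
  have : Module.Finite k (End X) := inferInstanceAs (Module.Finite k (X ⟶ X))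
  have ha : IsNilpotent a := by
    refine isNilpotent_of_forall_idempotent (k := k) a fun b hb hid => ?_
    obtain ⟨Z, i, e, h1, h2⟩ := IsIdempotentComplete.idempotents_split X (a * b : End X) hid
    have hab : (b : X ⟶ X) ≫ p ≫ q = (p ≫ q) ≫ b := hb.eq.trans rfl
    have h2' : e ≫ i = (b : X ⟶ X) ≫ p ≫ q := h2
    -- The idempotent `b ≫ p ≫ q` passes through `W`, so its image is a retract of `W` as well as of
    -- `X`.
    have hZ : IsZero Z := by
      refine h Z ⟨⟨i, e, h1⟩⟩ ⟨⟨i ≫ b ≫ p, q ≫ e, ?_⟩⟩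
      calc (i ≫ b ≫ p) ≫ q ≫ e = i ≫ (b ≫ p ≫ q) ≫ e := by simp
        _ = i ≫ (e ≫ i) ≫ e := by rw [h2']
        _ = 𝟙 Z := by simp [h1]
    rw [← h2, hZ.eq_of_src i 0, comp_zero]
  have hu := ha.isUnit_one_sub
  exact (isUnit_iff_isIso (C := C) (𝟙 X - p ≫ q)).1 hu

theorem one_le_finrank_end (k : Type w) [Field k] [Linear k C]
    [∀ X Y : C, Module.Finite k (X ⟶ Y)] {Y : C} (h : ¬ IsZero Y) : 1 ≤ Module.finrank k (Y ⟶ Y) := by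
  by_contra h'
  have h0 : Module.finrank k (Y ⟶ Y) = 0 := by omega
  have := Module.finrank_zero_iff.1 h0
  exact h ((IsZero.iff_id_eq_zero Y).2 (Subsingleton.elim _ _))

variable [HasBinaryBiproducts C]

/-- Over an idempotent complete category, a retract is a biproduct summand. -/
theorem exists_complement [IsIdempotentComplete C] {X Z : C} (r : Retract Z X) :
    ∃ Z' : C, Nonempty (X ≅ Z ⊞ Z') := by
  obtain ⟨Z', j, q, h1, h2⟩ := IsIdempotentComplete.idempotents_split X (𝟙 X - r.r ≫ r.i) (by simp)
  have hri : r.i ≫ (𝟙 X - r.r ≫ r.i) = 0 := by simp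
  have hrr : (𝟙 X - r.r ≫ r.i) ≫ r.r = 0 := by simp
  have hiq : r.i ≫ q = 0 := by
    have : (r.i ≫ q) ≫ j ≫ q = 0 := by 
      rw [Category.assoc, ← Category.assoc q, h2, ← Category.assoc, hri, zero_comp]
    rwa [h1, Category.comp_id] at this
  have hjr : j ≫ r.r = 0 := by
    have : (j ≫ q) ≫ j ≫ r.r = 0 := by rw [Category.assoc, ← Category.assoc q, h2, hrr, comp_zero]
    rwa [h1, Category.id_comp] at this
  refine ⟨Z', ⟨⟨biprod.lift r.r q, biprod.desc r.i j, ?_, ?_⟩⟩⟩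
  · rw [biprod.lift_desc, h2]; abel
  · ext <;> simp [hiq, hjr, h1]

/-- The dimension of the endomorphism algebra is the measure on which inductions over summands run:
block-diagonal endomorphisms already embed, so non-zero summands have strictly smaller measure. -/
theorem finrank_end_biprod_le (k : Type w) [Field k] [Linear k C]
    [∀ X Y : C, Module.Finite k (X ⟶ Y)] {X Y Z : C} (e : X ≅ Y ⊞ Z) :
    Module.finrank k (Y ⟶ Y) + Module.finrank k (Z ⟶ Z) ≤ Module.finrank k (X ⟶ X) := by
  rw [← Module.finrank_prod]
  let φ : ((Y ⟶ Y) × (Z ⟶ Z)) →ₗ[k] (X ⟶ X) :=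
    { toFun := fun f => e.hom ≫ biprod.fst ≫ f.1 ≫ biprod.inl ≫ e.inv +
        e.hom ≫ biprod.snd ≫ f.2 ≫ biprod.inr ≫ e.inv
      map_add' := fun f g => by simp; abel
      map_smul' := fun c f => by simp }
  refine LinearMap.finrank_le_finrank_of_injective (f := φ) ?_
  rw [← LinearMap.ker_eq_bot, LinearMap.ker_eq_bot']
  rintro ⟨f, g⟩ h
  have h : e.hom ≫ biprod.fst ≫ f ≫ biprod.inl ≫ e.inv +
        e.hom ≫ biprod.snd ≫ g ≫ biprod.inr ≫ e.inv = 0 := h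
  have h1 := congrArg (fun t => biprod.inl ≫ e.inv ≫ t ≫ e.hom ≫ biprod.fst) h
  have h2 := congrArg (fun t => biprod.inr ≫ e.inv ≫ t ≫ e.hom ≫ biprod.snd) h
  simp at h1 h2
  rw [h1, h2]; rfl

/-- Induction over the indecomposable summands of an object. -/
theorem induction_on_indecomposable (k : Type w) [Field k] [Linear k C]
    [∀ X Y : C, Module.Finite k (X ⟶ Y)] {P : C → Prop} (zero : ∀ X, IsZero X → P X)
    (indec : ∀ X, Indecomposable X → P X)
    (sum : ∀ X Y Z, (X ≅ Y ⊞ Z) → P Y → P Z → P X) (X : C) : P X := by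
  induction hn : Module.finrank k (X ⟶ X) using Nat.strong_induction_on generalizing X with
  | _ n ih =>
    subst hn
    by_cases h0 : IsZero X
    · exact zero X h0
    by_cases hi : Indecomposable X
    · exact indec X hi
    rw [Indecomposable] at hi
    push Not at hi
    obtain ⟨Y, Z, e, hY, hZ⟩ := hi h0
    have := finrank_end_biprod_le k e
    have hY' := one_le_finrank_end k hY
    have hZ' := one_le_finrank_end k hZ
    exact sum X Y Z e (ih _ (by omega) Y rfl) (ih _ (by omega) Z rfl)

variable [IsIdempotentComplete C]

/-- If `X ⊞ Y ≅ X' ⊞ Y'` and neither `X`, `Y'` nor `X'`, `Y` have common retracts, then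
`X ≅ X'`. -/
theorem nonempty_iso_of_biprod_iso (k : Type w) [Field k] [Linear k C]
    [∀ X Y : C, Module.Finite k (X ⟶ Y)] {X Y X' Y' : C} (e : X ⊞ Y ≅ X' ⊞ Y')
    (h : ∀ Z : C, Nonempty (Retract Z X) → Nonempty (Retract Z Y') → IsZero Z)
    (h' : ∀ Z : C, Nonempty (Retract Z X') → Nonempty (Retract Z Y) → IsZero Z) :
    Nonempty (X ≅ X') := by
  -- The diagonal blocks `f` and `g` of `e` and `e⁻¹` satisfy `f ≫ g = 1 - (X ⟶ Y' ⟶ X)`, and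
  -- symmetrically for `g ≫ f`. Both corrections are nilpotent, so `f` is split mono and split epi.
  have key := isIso_one_sub_of_factors k h (biprod.inl ≫ e.hom ≫ biprod.snd)
    (biprod.inr ≫ e.inv ≫ biprod.fst)
  have key' := isIso_one_sub_of_factors k h' (biprod.inl ≫ e.inv ≫ biprod.snd)
    (biprod.inr ≫ e.hom ≫ biprod.fst)
  let f : X ⟶ X' := biprod.inl ≫ e.hom ≫ biprod.fst
  let g : X' ⟶ X := biprod.inl ≫ e.inv ≫ biprod.fst
  have h1 : 𝟙 X - (biprod.inl ≫ e.hom ≫ biprod.snd) ≫ (biprod.inr ≫ e.inv ≫ biprod.fst) =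
      f ≫ g := by
    rw [sub_eq_iff_eq_add]
    have : 𝟙 X = (biprod.inl ≫ e.hom) ≫ (biprod.fst ≫ biprod.inl + biprod.snd ≫ biprod.inr) ≫
      e.inv ≫ biprod.fst := by simp
    rw [this]
    simp only [Preadditive.add_comp, Preadditive.comp_add, Category.assoc, f, g]
  have h2 : 𝟙 X' - (biprod.inl ≫ e.inv ≫ biprod.snd) ≫ (biprod.inr ≫ e.hom ≫ biprod.fst) =
      g ≫ f := by
    rw [sub_eq_iff_eq_add]
    have : 𝟙 X' = (biprod.inl ≫ e.inv) ≫ (biprod.fst ≫ biprod.inl + biprod.snd ≫ biprod.inr) ≫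
      e.hom ≫ biprod.fst := by simp
    rw [this]
    simp only [Preadditive.add_comp, Preadditive.comp_add, Category.assoc, f, g]
  rw [h1] at key
  rw [h2] at key'
  have hm : IsSplitMono f := ⟨⟨⟨g ≫ inv (f ≫ g), by rw [← Category.assoc, IsIso.hom_inv_id]⟩⟩⟩
  have he : IsSplitEpi f := ⟨⟨⟨inv (g ≫ f) ≫ g, by rw [Category.assoc, IsIso.inv_hom_id]⟩⟩⟩
  have : IsIso f := isIso_of_epi_of_isSplitMono f
  exact ⟨asIso f⟩

variable [HasFiniteBiproducts C]

/-- Non-zero summands in `add (S T)` are split off one at a time; the process stops because the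
dimension of the endomorphism algebra drops. -/
theorem exists_isDecomposition (k : Type w) [Field k] [Linear k C]
    [∀ X Y : C, Module.Finite k (X ⟶ Y)] (S : C ≌ C) (T X : C) :
    ∃ X' X'' : C, IsDecomposition S T X X' X'' := by
  induction hn : Module.finrank k (X ⟶ X) using Nat.strong_induction_on generalizing X with
  | _ n ih =>
    subst hn
    by_cases h : ∀ Z : C, InAdd (S.functor.obj T) Z → Nonempty (Retract Z X) → IsZero Z
    · obtain ⟨W, hW⟩ := HasZeroObject.zero (C := C)
      refine ⟨X, W, ⟨⟨⟨biprod.lift (𝟙 X) 0, biprod.fst, by simp, ?_⟩⟩, h,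
        InAdd.of_isZero _ hW⟩⟩
      ext
      · simp
      · simp
      · simp
      · exact hW.eq_of_src _ _
    · push Not at h
      obtain ⟨Z, hZ, ⟨r⟩, hZ0⟩ := h
      obtain ⟨X₁, ⟨e⟩⟩ := exists_complement r
      have := finrank_end_biprod_le k e
      have hZ' := one_le_finrank_end k hZ0
      obtain ⟨X', X'', ⟨e'⟩, h1, h2⟩ := ih _ (by omega) X₁ rfl
      refine ⟨X', Z ⊞ X'', ⟨⟨e ≪≫ ?_⟩, h1, hZ.biprod h2⟩⟩
      refine (biprod.mapIso (Iso.refl Z) e') ≪≫ ⟨biprod.lift (biprod.snd ≫ biprod.fst)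
        (biprod.lift biprod.fst (biprod.snd ≫ biprod.snd)),
        biprod.lift (biprod.snd ≫ biprod.fst) (biprod.lift biprod.fst (biprod.snd ≫ biprod.snd)),
        ?_, ?_⟩
      · ext <;> simp
      · ext <;> simp

theorem IsDecomposition.nonempty_iso (k : Type w) [Field k] [Linear k C]
    [∀ X Y : C, Module.Finite k (X ⟶ Y)] {S : C ≌ C} {T X Y X' X'' Y' Y'' : C}
    (hX : IsDecomposition S T X X' X'') (hY : IsDecomposition S T Y Y' Y'') (e : X ≅ Y) :
    Nonempty (X' ≅ Y') ∧ Nonempty (X'' ≅ Y'') := by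
  obtain ⟨a⟩ := hX.iso
  obtain ⟨b⟩ := hY.iso
  have e' : X' ⊞ X'' ≅ Y' ⊞ Y'' := a.symm ≪≫ e ≪≫ b
  have h1 : ∀ Z : C, Nonempty (Retract Z X') → Nonempty (Retract Z Y'') → IsZero Z :=
    fun Z h ⟨r⟩ => hX.no_summand Z (hY.mem_add.of_retract r) h
  have h2 : ∀ Z : C, Nonempty (Retract Z Y') → Nonempty (Retract Z X'') → IsZero Z :=
    fun Z h ⟨r⟩ => hY.no_summand Z (hX.mem_add.of_retract r) h
  exact ⟨nonempty_iso_of_biprod_iso k e' h1 h2,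
    nonempty_iso_of_biprod_iso k (biprod.braiding _ _ ≪≫ e' ≪≫ biprod.braiding _ _)
      (fun Z h h' => h2 Z h' h) (fun Z h h' => h1 Z h' h)⟩

end HomFinite

/-! ## Exactness of `(d+2)`-angles -/

section Exactness

variable {C : Type u} [Category.{v} C] [Preadditive C]

theorem exists_isTrivial [HasZeroObject C] (d : ℕ) (S : C ≌ C) (W : C) :
    ∃ A : SSeq d S, A.IsTrivial ∧ Nonempty (A.obj (Fin.last (d + 1)) ≅ W) := by
  classical
  obtain ⟨Z, hZ⟩ := HasZeroObject.zero (C := C)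
  let o : ℕ → C := fun i => if d ≤ i then W else Z
  have ho (i : ℕ) (h : d ≤ i) : o i = W := if_pos h
  refine ⟨⟨fun i => o i.val, fun i =>
    if h : d ≤ i.val then eqToHom ((ho _ (by simp; omega)).trans (ho _ h).symm) else 0, 0⟩,
    ⟨?_, fun i hi => ?_⟩, ⟨eqToIso (ho _ (by simp))⟩⟩
  · dsimp only
    rw [dif_pos (by simp)]
    infer_instance
  · change IsZero (if d ≤ i.val then W else Z)
    rwa [if_neg (by omega)]

/-- There is a sequence isomorphic to `0 ⟶ W ⟶ W ⟶ 0 ⟶ ⋯ ⟶ 0`, whose rotation is trivial. -/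
theorem exists_isTrivial_rotate [HasZeroObject C] (m : ℕ) (S : C ≌ C) [S.functor.Additive] (W : C) :
    ∃ A : SSeq (m + 1) S, A.rotate.IsTrivial ∧ IsZero (A.obj (Fin.last (m + 2))) ∧
      Nonempty (A.obj (Fin.last (m + 1)).castSucc ≅ W) := by
  classical
  obtain ⟨Z, hZ⟩ := HasZeroObject.zero (C := C)
  let o : ℕ → C := fun i => if i = m ∨ i = m + 1 then W else Z
  have ho (i : ℕ) (h : i = m ∨ i = m + 1) : o i = W := if_pos h
  have hz (i : ℕ) (h : ¬ (i = m ∨ i = m + 1)) : IsZero (o i) := by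
    simpa only [o, if_neg h] using hZ
  let A : SSeq (m + 1) S := ⟨fun i => o i.val, fun i =>
    if h : i.val = m then eqToHom ((ho _ (by simp; omega)).trans (ho _ (by simp; omega)).symm)
    else 0, 0⟩
  refine ⟨A, ⟨?_, fun i hi => ?_⟩, hz _ (by simp), ⟨eqToIso (ho _ (by simp))⟩⟩
  · change IsIso (A.map (Fin.last m).castSucc)
    dsimp only [A]
    rw [dif_pos (by simp)]
    infer_instance
  · induction i using Fin.cases with
    | zero =>
      change IsZero (S.functor.obj (o _))
      exact S.functor.map_isZero (hz _ (by simp; omega))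
    | succ i =>
      change IsZero (o _)
      refine hz _ ?_
      simp at hi ⊢
      omega

namespace Angulation

variable [HasBinaryBiproducts C] [HasZeroObject C] {m : ℕ} {S : C ≌ C} (𝒜 : Angulation (m + 1) S)

/-- The trivial angle on `X_{d+1}` maps to the given angle, extending the identity and the first
arrow. Its third object is zero, so commutativity of the next square kills the composite. -/
theorem isAngle_comp_last {A : SSeq (m + 1) S} (hA : 𝒜.IsAngle A) :
    A.map (Fin.last m).succ ≫ A.map (Fin.last m).castSucc = 0 := by
  obtain ⟨B, hB, ⟨e⟩⟩ := exists_isTrivial (m + 1) S (A.obj (Fin.last (m + 2)))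
  have := hB.1
  obtain ⟨φ, h1, h2, -⟩ := 𝒜.exists_hom (𝒜.trivial hB) hA e.hom
    (inv (B.map (Fin.last (m + 1))) ≫ e.hom ≫ A.map (Fin.last (m + 1))) (by simp)
  have h3 := φ.comm (Fin.last m).castSucc
  have hz : φ.app (Fin.last m).castSucc.castSucc = 0 := (hB.2 _ (by simp)).eq_of_src _ _
  rw [hz, comp_zero] at h3
  have h2 : φ.app (Fin.last m).castSucc.succ =
    inv (B.map (Fin.last (m + 1))) ≫ e.hom ≫ A.map (Fin.last (m + 1)) := h2
  rw [h2] at h3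
  have h4 : inv (B.map (Fin.last (m + 1))) ≫ e.hom ≫ A.map (Fin.last m).succ ≫
    A.map (Fin.last m).castSucc = 0 := by simpa using h3.symm
  simpa using h4

/-- The rotated trivial angle on `W` starts with `W ⟶ 0`, so `f` extends to a morphism into the
rotated angle. Its component `S W ⟶ S X_{d+1}` desuspends to the lift. -/
theorem exists_lift_last {A : SSeq (m + 1) S} (hA : 𝒜.IsAngle A) {W : C}
    (f : W ⟶ A.obj (Fin.last m).castSucc.succ) (hf : f ≫ A.map (Fin.last m).castSucc = 0) :
    ∃ g : W ⟶ A.obj (Fin.last m).succ.succ, g ≫ A.map (Fin.last m).succ = f := by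
  obtain ⟨B, hB, ⟨e⟩⟩ := exists_isTrivial (m + 1) S W
  have := hB.1
  have hz : IsZero (B.obj (Fin.last m).castSucc.castSucc) := hB.2 _ (by simp)
  let t : B.obj (Fin.last (m + 1)).castSucc ⟶ W := inv (B.map (Fin.last (m + 1))) ≫ e.hom
  obtain ⟨φ, h1, -, -⟩ := 𝒜.exists_hom ((𝒜.rotate_iff _).1 (𝒜.trivial hB))
    ((𝒜.rotate_iff _).1 hA) (t ≫ f) 0 (by
      change B.map (Fin.last m).castSucc ≫ 0 = (t ≫ f) ≫ A.map (Fin.last m).castSucc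
      rw [Category.assoc, hf, comp_zero, comp_zero])
  have h3 := φ.comm_conn
  have h1 : φ.app (Fin.last (m + 2)) = t ≫ f := h1
  rw [h1] at h3
  let ψ : S.functor.obj (B.obj (Fin.last (m + 2))) ⟶ S.functor.obj (A.obj (Fin.last (m + 2))) :=
    φ.app 0
  have h4 : S.functor.map (B.map (Fin.last (m + 1)) ≫ t ≫ f) =
      ψ ≫ S.functor.map (A.map (Fin.last (m + 1))) := by
    have h5 : ((-1 : ℤ) ^ (m + 1 + 2) • S.functor.map (B.map (Fin.last (m + 1)))) ≫
      S.functor.map (t ≫ f) = ψ ≫ ((-1 : ℤ) ^ (m + 1 + 2) •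
        S.functor.map (A.map (Fin.last (m + 1)))) := h3
    rw [Preadditive.zsmul_comp, Preadditive.comp_zsmul] at h5
    -- Both connecting maps carry the same rotation sign; multiplying by it once more removes it.
    have h6 := congrArg (fun x => (-1 : ℤ) ^ (m + 1 + 2) • x) h5
    simp only [smul_smul, ← mul_pow] at h6
    rw [S.functor.map_comp]
    simpa using h6
  refine ⟨e.inv ≫ S.functor.preimage ψ, S.functor.map_injective ?_⟩
  have h7 : S.functor.map (S.functor.preimage ψ ≫ A.map (Fin.last (m + 1))) =
      S.functor.map (B.map (Fin.last (m + 1)) ≫ t ≫ f) := by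
    rw [h4, S.functor.map_comp, S.functor.map_preimage]
  have h8 := S.functor.map_injective h7
  have h9 : (e.inv ≫ S.functor.preimage ψ) ≫ A.map (Fin.last (m + 1)) = f := by
    rw [Category.assoc, h8]
    simp [t]
  exact congrArg _ h9

/-- Consecutive morphisms of a `(d+2)`-angle compose to zero. -/
theorem isAngle_comp (i : ℕ) (hi : i < m + 1) {A : SSeq (m + 1) S} (hA : 𝒜.IsAngle A) :
    A.map (Fin.succ ⟨i, hi⟩) ≫ A.map (Fin.castSucc ⟨i, hi⟩) = 0 := by
  -- A rotation moves the arrow of index `i` to index `i + 1`, definitionally. After `m - i`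
  -- rotations the statement is about the left end of an angle.
  obtain ⟨j, hj⟩ : ∃ j, i + j = m := ⟨m - i, by omega⟩
  induction j generalizing i A with
  | zero => obtain rfl : i = m := hj; exact 𝒜.isAngle_comp_last hA
  | succ j ih => exact ih (i + 1) (by omega) ((𝒜.rotate_iff _).1 hA) (by omega)

/-- Covariant exactness of a `(d+2)`-angle. -/
theorem exists_lift (i : ℕ) (hi : i < m + 1) {A : SSeq (m + 1) S} (hA : 𝒜.IsAngle A) {W : C}
    (f : W ⟶ A.obj (Fin.castSucc ⟨i, hi⟩).succ) (hf : f ≫ A.map (Fin.castSucc ⟨i, hi⟩) = 0) :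
    ∃ g : W ⟶ A.obj (Fin.succ ⟨i, hi⟩).succ, g ≫ A.map (Fin.succ ⟨i, hi⟩) = f := by
  obtain ⟨j, hj⟩ : ∃ j, i + j = m := ⟨m - i, by omega⟩
  induction j generalizing i A with
  | zero => obtain rfl : i = m := hj; exact 𝒜.exists_lift_last hA f hf
  | succ j ih => exact ih (i + 1) (by omega) ((𝒜.rotate_iff _).1 hA) f hf (by omega)

/-- Covariant exactness of a `(d+2)`-angle at `X_0`. -/
theorem exists_lift_conn {A : SSeq (m + 1) S} (hA : 𝒜.IsAngle A) {W : C}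
    (f : W ⟶ A.obj 0) (hf : f ≫ A.conn = 0) :
    ∃ g : W ⟶ A.obj 1, g ≫ A.map 0 = f :=
  𝒜.exists_lift 0 m.succ_pos ((𝒜.rotate_iff _).1 hA) f hf

theorem map_comp_conn {A : SSeq (m + 1) S} (hA : 𝒜.IsAngle A) : A.map 0 ≫ A.conn = 0 :=
  𝒜.isAngle_comp 0 m.succ_pos ((𝒜.rotate_iff _).1 hA)

theorem conn_comp_map {A : SSeq (m + 1) S} (hA : 𝒜.IsAngle A) :
    A.conn ≫ S.functor.map (A.map (Fin.last (m + 1))) = 0 := by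
  have h : A.conn ≫ ((-1 : ℤ) ^ (m + 1 + 2) • S.functor.map (A.map (Fin.last (m + 1)))) = 0 :=
    𝒜.map_comp_conn ((𝒜.rotate_iff _).1 hA)
  rw [Preadditive.comp_zsmul] at h
  have h6 := congrArg (fun x => (-1 : ℤ) ^ (m + 1 + 2) • x) h
  simp only [smul_smul, ← mul_pow] at h6
  simpa using h6

/-- Covariant exactness of a `(d+2)`-angle at `S X_{d+1}`. -/
theorem exists_lift_susp {A : SSeq (m + 1) S} (hA : 𝒜.IsAngle A) {W : C}
    (f : W ⟶ S.functor.obj (A.obj (Fin.last (m + 2))))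
    (hf : f ≫ S.functor.map (A.map (Fin.last (m + 1))) = 0) :
    ∃ g : W ⟶ A.obj 0, g ≫ A.conn = f :=
  𝒜.exists_lift_conn ((𝒜.rotate_iff _).1 hA) f
    (by
      have : f ≫ ((-1 : ℤ) ^ (m + 1 + 2) • S.functor.map (A.map (Fin.last (m + 1)))) = 0 := by
        rw [Preadditive.comp_zsmul, hf, smul_zero]
      exact this)

variable [S.functor.Additive]

/-- Dual to the lifting: `f` is extended to a morphism into the angle `0 ⟶ W ⟶ W ⟶ 0 ⟶ ⋯`, and its
next component is the required factor. -/
theorem exists_desc_last {A : SSeq (m + 1) S} (hA : 𝒜.IsAngle A) {W : C}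
    (f : A.obj (Fin.last m).succ.castSucc ⟶ W) (hf : A.map (Fin.last m).succ ≫ f = 0) :
    ∃ g : A.obj (Fin.last m).castSucc.castSucc ⟶ W, A.map (Fin.last m).castSucc ≫ g = f := by
  obtain ⟨B, hB, hz, ⟨e⟩⟩ := exists_isTrivial_rotate m S W
  have : IsIso (B.map (Fin.last m).castSucc) := hB.1
  obtain ⟨φ, -, h2, -⟩ := 𝒜.exists_hom hA ((𝒜.rotate_iff _).2 (𝒜.trivial hB)) 0 (f ≫ e.inv) (by
    rw [zero_comp]
    have : A.map (Fin.last m).succ ≫ f ≫ e.inv = 0 := by rw [← Category.assoc, hf, zero_comp]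
    exact this)
  have h3 := φ.comm (Fin.last m).castSucc
  have h2 : φ.app (Fin.last m).castSucc.succ = f ≫ e.inv := h2
  rw [h2] at h3
  refine ⟨φ.app _ ≫ inv (B.map (Fin.last m).castSucc) ≫ e.hom, ?_⟩
  rw [← Category.assoc, h3]
  have : (f ≫ e.inv) ≫ B.map (Fin.last m).castSucc ≫ inv (B.map (Fin.last m).castSucc) ≫
    e.hom = f := by rw [IsIso.hom_inv_id_assoc, Category.assoc, e.inv_hom_id, Category.comp_id]
  simpa only [Category.assoc] using this

/-- Contravariant exactness of a `(d+2)`-angle. -/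
theorem exists_desc (i : ℕ) (hi : i < m + 1) {A : SSeq (m + 1) S} (hA : 𝒜.IsAngle A) {W : C}
    (f : A.obj (Fin.succ ⟨i, hi⟩).castSucc ⟶ W) (hf : A.map (Fin.succ ⟨i, hi⟩) ≫ f = 0) :
    ∃ g : A.obj (Fin.castSucc ⟨i, hi⟩).castSucc ⟶ W, A.map (Fin.castSucc ⟨i, hi⟩) ≫ g = f := by
  obtain ⟨j, hj⟩ : ∃ j, i + j = m := ⟨m - i, by omega⟩
  induction j generalizing i A with
  | zero => obtain rfl : i = m := hj; exact 𝒜.exists_desc_last hA f hf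
  | succ j ih => exact ih (i + 1) (by omega) ((𝒜.rotate_iff _).1 hA) f hf (by omega)

/-- Contravariant exactness of a `(d+2)`-angle at `X_0`. -/
theorem exists_desc_conn {A : SSeq (m + 1) S} (hA : 𝒜.IsAngle A) {W : C}
    (f : A.obj 0 ⟶ W) (hf : A.map 0 ≫ f = 0) :
    ∃ g : S.functor.obj (A.obj (Fin.last (m + 2))) ⟶ W, A.conn ≫ g = f :=
  𝒜.exists_desc 0 m.succ_pos ((𝒜.rotate_iff _).1 hA) f hf

/-- Contravariant exactness of a `(d+2)`-angle at `S X_{d+1}`. -/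
theorem exists_desc_susp {A : SSeq (m + 1) S} (hA : 𝒜.IsAngle A) {W : C}
    (f : S.functor.obj (A.obj (Fin.last (m + 2))) ⟶ W) (hf : A.conn ≫ f = 0) :
    ∃ g : S.functor.obj (A.obj (Fin.last (m + 1)).castSucc) ⟶ W,
      S.functor.map (A.map (Fin.last (m + 1))) ≫ g = f := by
  obtain ⟨g, hg⟩ := 𝒜.exists_desc_conn ((𝒜.rotate_iff _).1 hA) f hf
  refine ⟨(-1 : ℤ) ^ (m + 1 + 2) • (show S.functor.obj (A.obj (Fin.last (m + 1)).castSucc) ⟶ W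
    from g), ?_⟩
  have hg : ((-1 : ℤ) ^ (m + 1 + 2) • S.functor.map (A.map (Fin.last (m + 1)))) ≫
    (show S.functor.obj (A.obj (Fin.last (m + 1)).castSucc) ⟶ W from g) = f := hg
  rw [Preadditive.zsmul_comp] at hg
  rw [Preadditive.comp_zsmul, hg]

end Angulation

end Exactness

/-! ## Stable equivalence and syzygies -/

section Stable

variable {R : Type v} [Ring R]

/-- The map `f` factors through a projective module. -/
def FactorsThroughProjective {L K : Type v} [AddCommGroup L] [Module R L] [AddCommGroup K]
    [Module R K] (f : L →ₗ[R] K) : Prop :=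
  ∃ (P : ModuleCat.{v} R) (a : L →ₗ[R] P) (b : P →ₗ[R] K), Module.Projective R P ∧ f = b ∘ₗ a

/-- The modules `L` and `K` are isomorphic up to maps that factor through projective modules. -/
def StablyEquivalent (R : Type v) [Ring R] (L K : Type v) [AddCommGroup L] [Module R L]
    [AddCommGroup K] [Module R K] : Prop :=
  ∃ (f : L →ₗ[R] K) (g : K →ₗ[R] L), FactorsThroughProjective (g ∘ₗ f - LinearMap.id) ∧
    FactorsThroughProjective (f ∘ₗ g - LinearMap.id)

theorem exists_factor_of_exact {L' P L X : Type*} [AddCommGroup L'] [Module R L'] [AddCommGroup P]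
    [Module R P] [AddCommGroup L] [Module R L] [AddCommGroup X] [Module R X]
    {ι : L' →ₗ[R] P} {π : P →ₗ[R] L} (hι : Function.Injective ι) (hex : Function.Exact ι π)
    (h : X →ₗ[R] P) (hh : π ∘ₗ h = 0) : ∃ h' : X →ₗ[R] L', ι ∘ₗ h' = h := by
  have H (x : X) : ∃ y, ι y = h x := (hex _).1 (LinearMap.congr_fun hh x)
  choose t ht using H
  exact ⟨{ toFun := t
           map_add' := fun x y => hι (by rw [map_add, ht, ht, ht, map_add])
           map_smul' := fun r x => hι (by rw [ht, map_smul, map_smul, ht]; rfl) },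
    LinearMap.ext ht⟩

/-- If `e - 1` factors as `b ∘ a` through a projective and `s` lifts `b` along `π`, then `e₀ - 1 - s
∘ a ∘ π` lands in the kernel `L'`. On `L'` the correction `s ∘ a ∘ π` disappears, which leaves a map
extended from `P`. -/
theorem exists_sub_id_eq_comp {L' P L : Type v} [AddCommGroup L'] [Module R L'] [AddCommGroup P]
    [Module R P] [AddCommGroup L] [Module R L]
    {ι : L' →ₗ[R] P} {π : P →ₗ[R] L} (hι : Function.Injective ι) (hex : Function.Exact ι π)
    (hπ : Function.Surjective π) {e : L →ₗ[R] L} {e₀ : P →ₗ[R] P} {e₁ : L' →ₗ[R] L'}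
    (he : FactorsThroughProjective (e - LinearMap.id)) (h₀ : π ∘ₗ e₀ = e ∘ₗ π)
    (h₁ : ι ∘ₗ e₁ = e₀ ∘ₗ ι) : ∃ h : P →ₗ[R] L', e₁ - LinearMap.id = h ∘ₗ ι := by
  obtain ⟨E, a, b, hE, hab⟩ := he
  obtain ⟨s, hs⟩ := Module.projective_lifting_property π b hπ
  obtain ⟨h, hh⟩ := exists_factor_of_exact hι hex (e₀ - LinearMap.id - s ∘ₗ a ∘ₗ π) (by
    rw [LinearMap.comp_sub, LinearMap.comp_sub, h₀, ← LinearMap.comp_assoc, hs,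
      ← LinearMap.comp_assoc, ← hab, LinearMap.sub_comp]
    simp)
  refine ⟨h, LinearMap.ext fun x => hι ?_⟩
  have hx : π (ι x) = 0 := hex.apply_apply_eq_zero x
  have := LinearMap.congr_fun hh (ι x)
  have h2 := LinearMap.congr_fun h₁ x
  simp only [LinearMap.comp_apply, LinearMap.sub_apply, LinearMap.id_apply, hx, map_zero,
    sub_zero] at this h2 ⊢
  rw [this, map_sub, h2]

/-- A stable equivalence lifts to projective covers and induces a stable equivalence of
syzygies. -/
theorem StablyEquivalent.exists_lift {L' P L K' Q K : Type v} [AddCommGroup L'] [Module R L']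
    [AddCommGroup P] [Module R P] [AddCommGroup L] [Module R L] [AddCommGroup K'] [Module R K']
    [AddCommGroup Q] [Module R Q] [AddCommGroup K] [Module R K] (h : StablyEquivalent R L K)
    {ι : L' →ₗ[R] P} {π : P →ₗ[R] L} (hι : Function.Injective ι) (hex : Function.Exact ι π)
    (hπ : Function.Surjective π) [Module.Projective R P]
    {κ : K' →ₗ[R] Q} {ρ : Q →ₗ[R] K} (hκ : Function.Injective κ) (hex' : Function.Exact κ ρ)
    (hρ : Function.Surjective ρ) [Module.Projective R Q] :
    ∃ (f₀ : P →ₗ[R] Q) (g₀ : Q →ₗ[R] P) (f₁ : L' →ₗ[R] K') (g₁ : K' →ₗ[R] L'),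
      κ ∘ₗ f₁ = f₀ ∘ₗ ι ∧ ι ∘ₗ g₁ = g₀ ∘ₗ κ ∧
      (∃ h : P →ₗ[R] L', g₁ ∘ₗ f₁ - LinearMap.id = h ∘ₗ ι) ∧
      ∃ h : Q →ₗ[R] K', f₁ ∘ₗ g₁ - LinearMap.id = h ∘ₗ κ := by
  obtain ⟨f, g, hgf, hfg⟩ := h
  obtain ⟨f₀, hf₀⟩ := Module.projective_lifting_property ρ (f ∘ₗ π) hρ
  obtain ⟨g₀, hg₀⟩ := Module.projective_lifting_property π (g ∘ₗ ρ) hπ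
  obtain ⟨f₁, hf₁⟩ := exists_factor_of_exact hκ hex' (f₀ ∘ₗ ι) (by
    rw [← LinearMap.comp_assoc, hf₀, LinearMap.comp_assoc, hex.linearMap_comp_eq_zero,
      LinearMap.comp_zero])
  obtain ⟨g₁, hg₁⟩ := exists_factor_of_exact hι hex (g₀ ∘ₗ κ) (by
    rw [← LinearMap.comp_assoc, hg₀, LinearMap.comp_assoc, hex'.linearMap_comp_eq_zero,
      LinearMap.comp_zero])
  refine ⟨f₀, g₀, f₁, g₁, hf₁, hg₁, ?_, ?_⟩
  · refine exists_sub_id_eq_comp hι hex hπ hgf (e₀ := g₀ ∘ₗ f₀) ?_ ?_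
    · rw [← LinearMap.comp_assoc, hg₀, LinearMap.comp_assoc, hf₀, LinearMap.comp_assoc]
    · rw [← LinearMap.comp_assoc, hg₁, LinearMap.comp_assoc, hf₁, LinearMap.comp_assoc]
  · refine exists_sub_id_eq_comp hκ hex' hρ hfg (e₀ := f₀ ∘ₗ g₀) ?_ ?_
    · rw [← LinearMap.comp_assoc, hf₀, LinearMap.comp_assoc, hg₀, LinearMap.comp_assoc]
    · rw [← LinearMap.comp_assoc, hf₁, LinearMap.comp_assoc, hg₁, LinearMap.comp_assoc]

theorem StablyEquivalent.syzygy {L' P L K' Q K : Type v} [AddCommGroup L'] [Module R L']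
    [AddCommGroup P] [Module R P] [AddCommGroup L] [Module R L] [AddCommGroup K'] [Module R K']
    [AddCommGroup Q] [Module R Q] [AddCommGroup K] [Module R K] (h : StablyEquivalent R L K)
    {ι : L' →ₗ[R] P} {π : P →ₗ[R] L} (hι : Function.Injective ι) (hex : Function.Exact ι π)
    (hπ : Function.Surjective π) [hP : Module.Projective R P]
    {κ : K' →ₗ[R] Q} {ρ : Q →ₗ[R] K} (hκ : Function.Injective κ) (hex' : Function.Exact κ ρ)
    (hρ : Function.Surjective ρ) [hQ : Module.Projective R Q] : StablyEquivalent R L' K' := by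
  obtain ⟨f₀, g₀, f₁, g₁, -, -, ⟨h, hh⟩, h', hh'⟩ := h.exists_lift hι hex hπ hκ hex' hρ
  exact ⟨f₁, g₁, ⟨ModuleCat.of R P, ι, h, hP, hh⟩, ⟨ModuleCat.of R Q, κ, h', hQ, hh'⟩⟩

theorem StablyEquivalent.of_equiv {L K : Type v} [AddCommGroup L] [Module R L] [AddCommGroup K]
    [Module R K] (e : L ≃ₗ[R] K) : StablyEquivalent R L K :=
  have hP : Module.Projective R PUnit.{v + 1} := inferInstance
  ⟨e, e.symm, ⟨ModuleCat.of R PUnit, 0, 0, hP, by ext; simp⟩,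
    ⟨ModuleCat.of R PUnit, 0, 0, hP, by ext; simp⟩⟩

theorem StablyEquivalent.symm {L K : Type v} [AddCommGroup L] [Module R L] [AddCommGroup K]
    [Module R K] (h : StablyEquivalent R L K) : StablyEquivalent R K L := by
  obtain ⟨f, g, h1, h2⟩ := h
  exact ⟨g, f, h2, h1⟩

/-- That all maps from `P₁` to `M` factor through the presentation `P₁ ⟶ P` of `L` depends only on
the stable class of `L`, as long as `P₁` has no summand mapping to zero in `P`. -/
theorem StablyEquivalent.factors_through_presentation
    {P₁ L' P L Q₁ K' Q K M : Type v} [AddCommGroup L']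
    [Module R L'] [AddCommGroup P] [Module R P] [AddCommGroup L] [Module R L] [AddCommGroup K']
    [Module R K'] [AddCommGroup Q] [Module R Q] [AddCommGroup K] [Module R K] [AddCommGroup P₁]
    [Module R P₁] [AddCommGroup Q₁] [Module R Q₁] [AddCommGroup M] [Module R M]
    (h : StablyEquivalent R L K)
    {ι : L' →ₗ[R] P} {π : P →ₗ[R] L} (hι : Function.Injective ι) (hex : Function.Exact ι π)
    (hπ : Function.Surjective π) [Module.Projective R P]
    {κ : K' →ₗ[R] Q} {ρ : Q →ₗ[R] K} (hκ : Function.Injective κ) (hex' : Function.Exact κ ρ)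
    (hρ : Function.Surjective ρ) [Module.Projective R Q]
    {p : P₁ →ₗ[R] L'} (hp : Function.Surjective p) [Module.Projective R P₁]
    {q : Q₁ →ₗ[R] K'} (hq : Function.Surjective q) [Module.Projective R Q₁]
    (hQ : ∀ ε : Q₁ →ₗ[R] Q₁, q ∘ₗ ε = 0 → ∃ u : Q₁ →ₗ[R] Q₁,
      u ∘ₗ (LinearMap.id + ε) = LinearMap.id)
    (hP : ∀ φ : P₁ →ₗ[R] M, ∃ ψ : P →ₗ[R] M, φ = ψ ∘ₗ ι ∘ₗ p) (φ : Q₁ →ₗ[R] M) :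
    ∃ ψ : Q →ₗ[R] M, φ = ψ ∘ₗ κ ∘ₗ q := by
  obtain ⟨f₀, g₀, f₁, g₁, hf, hg, -, h', hh'⟩ := h.exists_lift hι hex hπ hκ hex' hρ
  obtain ⟨f₂, hf₂⟩ := Module.projective_lifting_property q (f₁ ∘ₗ p) hq
  obtain ⟨g₂, hg₂⟩ := Module.projective_lifting_property p (g₁ ∘ₗ q) hp
  obtain ⟨r, hr⟩ := Module.projective_lifting_property q h' hq
  -- Comparing presentations back and forth is the identity on `Q₁` only up to `r ∘ κ ∘ q` and an
  -- error killed by `q`. The hypothesis on `Q₁` makes the identity plus this error left invertible,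
  -- so `φ = φ ∘ u ∘ (f₂ ∘ g₂ - r ∘ κ ∘ q)`, and both terms factor through `κ ∘ q`.
  obtain ⟨u, hu⟩ := hQ (f₂ ∘ₗ g₂ - LinearMap.id - r ∘ₗ κ ∘ₗ q) (by
    ext x
    have e1 := LinearMap.congr_fun hf₂ (g₂ x)
    have e2 := LinearMap.congr_fun hg₂ x
    have e3 := LinearMap.congr_fun hr (κ (q x))
    have e4 := LinearMap.congr_fun hh' (q x)
    simp only [LinearMap.comp_apply, LinearMap.sub_apply, LinearMap.id_apply, map_sub,
      LinearMap.zero_apply] at e1 e2 e3 e4 ⊢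
    rw [e1, e2, e3, e4, sub_self])
  obtain ⟨ψ, hψ⟩ := hP (φ ∘ₗ u ∘ₗ f₂)
  refine ⟨ψ ∘ₗ g₀ - φ ∘ₗ u ∘ₗ r, LinearMap.ext fun x => ?_⟩
  have e1 := LinearMap.congr_fun hu x
  have e2 := LinearMap.congr_fun hψ (g₂ x)
  have e3 := LinearMap.congr_fun hg₂ x
  have e4 := LinearMap.congr_fun hg (q x)
  simp only [LinearMap.comp_apply, LinearMap.sub_apply, LinearMap.add_apply,
    LinearMap.id_apply, map_sub, map_add] at e1 e2 e3 e4 ⊢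
  rw [e3, e4] at e2
  rw [← e2, ← map_sub, ← map_sub]
  conv_lhs => rw [← e1]
  congr 1
  rw [map_sub]
  abel

end Stable

/-! ## Homomorphisms into the Auslander–Reiten translate -/

section Tau

variable {R : Type v} [Ring R]

theorem exists_dualBasis (P : Type v) [AddCommGroup P] [Module R P] [Module.Finite R P]
    [Module.Projective R P] :
    ∃ (n : ℕ) (c : Fin n → P) (c' : Fin n → (P →ₗ[R] R)), ∀ x, ∑ j, c' j x • c j = x := by
  obtain ⟨n, f, g, -, -, h⟩ := Module.Finite.exists_comp_eq_id_of_projective R P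
  refine ⟨n, fun j => f (Pi.single j 1), fun j => LinearMap.proj j ∘ₗ g, fun x => ?_⟩
  conv_rhs => rw [← LinearMap.id_apply (R := R) x, ← h, LinearMap.comp_apply,
    ← Finset.univ_sum_single (g x)]
  rw [map_sum]
  refine Finset.sum_congr rfl fun j _ => ?_
  rw [← map_smul]
  congr 1
  ext i
  by_cases hi : i = j
  · subst hi; simp
  · simp [Pi.single_eq_of_ne hi]

variable (k : Type w) [Field k] [Algebra k R]

/-- There are no non-zero maps from `M` to the kernel of `ν ∂`, for a map `∂ : A ⟶ B` of finitely
generated projective modules, if and only if all maps from `A` to `M` factor through `∂`. -/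
theorem hom_ker_nakayamaMap_eq_zero_iff {A B M : Type v} [AddCommGroup A] [Module R A]
    [AddCommGroup B] [Module R B] [AddCommGroup M] [Module R M] [Module.Finite R A]
    [Module.Projective R A] [Module.Finite R B] [Module.Projective R B] (δ : A →ₗ[R] B) :
    (∀ F : M →ₗ[R] LinearMap.ker (nakayamaMap k δ), F = 0) ↔
      ∀ χ : A →ₗ[R] M, ∃ ψ : B →ₗ[R] M, χ = ψ ∘ₗ δ := by
  obtain ⟨n, c, c', hc⟩ := exists_dualBasis (R := R) A
  obtain ⟨m, b, b', hb⟩ := exists_dualBasis (R := R) B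
  constructor
  · intro H χ
    let _ : Module k M := Module.compHom M (algebraMap k R)
    have : IsScalarTower k R M := ⟨fun a r x => by
      change (a • r) • x = algebraMap k R a • r • x
      rw [Algebra.smul_def, mul_smul]⟩
    have : SMulCommClass R k M := IsScalarTower.to_smulCommClass'
    let V : Submodule k (A →ₗ[R] M) :=
      { carrier := {χ | ∃ ψ : B →ₗ[R] M, χ = ψ ∘ₗ δ}
        add_mem' := by rintro _ _ ⟨ψ, rfl⟩ ⟨ψ', rfl⟩; exact ⟨ψ + ψ', rfl⟩
        zero_mem' := ⟨0, rfl⟩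
        smul_mem' := by rintro a _ ⟨ψ, rfl⟩; exact ⟨a • ψ, rfl⟩ }
    -- This is the duality `Hom(M, ν A) ≅ D Hom(A, M)`: a functional `l` vanishing on the maps
    -- through `δ` but not at `χ` gives the map `x ↦ (h ↦ l (h(-) x))` from `M` into `ker ν δ`, and
    -- a dual basis of `A` recovers `l χ` from it.
    by_contra hχ
    obtain ⟨l, hl, hlV⟩ := Submodule.exists_le_ker_of_notMem (show χ ∉ V from hχ)
    let t (x : M) : (A →ₗ[R] R) →ₗ[k] (A →ₗ[R] M) :=
      { toFun := fun h => LinearMap.toSpanSingleton R M x ∘ₗ h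
        map_add' := fun h h' => by ext y; simp [add_smul]
        map_smul' := fun a h => by ext y; simp }
    let F : M →ₗ[R] Nakayama (R := R) k A :=
      { toFun := fun x => l ∘ₗ t x
        map_add' := fun x y => LinearMap.ext fun h => by
          change l (t (x + y) h) = l (t x h) + l (t y h)
          rw [← map_add]; congr 1; ext z; simp [t]
        map_smul' := fun r x => LinearMap.ext fun h => by
          change l (t (r • x) h) = l (t x (mulRight k A r h))
          congr 1; ext z; simp [t, mulRight, mul_smul] }
    have hF : ∀ x, F x ∈ LinearMap.ker (nakayamaMap k δ) := fun x => by
      rw [LinearMap.mem_ker]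
      refine LinearMap.ext fun h => ?_
      change l (t x (h ∘ₗ δ)) = 0
      exact hlV ⟨LinearMap.toSpanSingleton R M x ∘ₗ h, rfl⟩
    have hF0 := H (F.codRestrict _ hF)
    have hF1 (x : M) (h : A →ₗ[R] R) : l (t x h) = 0 := by
      have h1 : F x = 0 := congrArg Subtype.val (LinearMap.congr_fun hF0 x)
      exact LinearMap.congr_fun (show (F x : Module.Dual k (A →ₗ[R] R)) = 0 from h1) h
    refine hl ?_
    have : χ = ∑ j, t (χ (c j)) (c' j) := by
      ext x
      conv_lhs => rw [← hc x, map_sum]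
      simp [t]
    rw [this, map_sum]
    exact Finset.sum_eq_zero fun j _ => hF1 _ _
  · intro H F
    ext x
    let G (x : M) : Module.Dual k (A →ₗ[R] R) := (F x).1
    have hGs (r : R) (x : M) (h : A →ₗ[R] R) : G (r • x) h = G x (mulRight k A r h) := by
      have : (F (r • x)).1 = r • (F x).1 := by rw [map_smul]; rfl
      exact LinearMap.congr_fun (show G (r • x) = (show Module.Dual k (A →ₗ[R] R) from r • (F x).1)
        from this) h
    have hGa {ι : Type} (s : Finset ι) (f : ι → M) : G (∑ i ∈ s, f i) = ∑ i ∈ s, G (f i) := by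
      have : (F (∑ i ∈ s, f i)).1 = ∑ i ∈ s, (F (f i)).1 := by
        rw [map_sum]; exact Submodule.coe_sum _ _ _
      exact this
    have hGk (x : M) (h : B →ₗ[R] R) : G x (h ∘ₗ δ) = 0 :=
      LinearMap.congr_fun (show (nakayamaMap k δ (F x).1 : Module.Dual k (B →ₗ[R] R)) = 0 from
        LinearMap.mem_ker.1 (F x).2) h
    refine LinearMap.ext fun h => ?_
    change G x h = 0
    -- Factoring `h(-) x` through `δ` and expanding in dual bases rewrites `F x h` as a sum of
    -- values of `F` on maps `b' i ∘ δ`, where it vanishes.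
    obtain ⟨ψ, hψ⟩ := H (LinearMap.toSpanSingleton R M x ∘ₗ h)
    have hψ' (y : A) : h y • x = ∑ i, b' i (δ y) • ψ (b i) := by
      have := LinearMap.congr_fun hψ y
      simp only [LinearMap.comp_apply, LinearMap.toSpanSingleton_apply] at this
      rw [this, ← hb (δ y), map_sum]
      simp [hb]
    have h1 : h = ∑ j, mulRight k A (h (c j)) (c' j) := by
      ext y
      conv_lhs => rw [← hc y, map_sum]
      simp [mulRight]
    have h2 (i : Fin m) : b' i ∘ₗ δ = ∑ j, mulRight k A (b' i (δ (c j))) (c' j) := by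
      ext y
      conv_lhs => rw [← hc y, map_sum]
      simp [mulRight]
    calc G x h = ∑ j, G (h (c j) • x) (c' j) := by
          conv_lhs => rw [h1, map_sum]
          exact Finset.sum_congr rfl fun j _ => (hGs _ _ _).symm
      _ = ∑ j, ∑ i, G (ψ (b i)) (mulRight k A (b' i (δ (c j))) (c' j)) := by
          refine Finset.sum_congr rfl fun j _ => ?_
          rw [hψ', hGa, LinearMap.sum_apply]
          exact Finset.sum_congr rfl fun i _ => hGs _ _ _
      _ = ∑ i, G (ψ (b i)) (b' i ∘ₗ δ) := by
          rw [Finset.sum_comm]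
          refine Finset.sum_congr rfl fun i _ => ?_
          rw [h2, map_sum]
      _ = 0 := Finset.sum_eq_zero fun i _ => hGk _ _

/-- `1 + ε` agrees with the identity modulo `ker π`, so it is surjective by superfluity, and a
surjective endomorphism of a Noetherian module is bijective. -/
theorem ProjCover.exists_inverse [IsNoetherianRing R] {M : ModuleCat.{v} R} (c : ProjCover M)
    (ε : c.P →ₗ[R] c.P) (hε : c.π ∘ₗ ε = 0) :
    ∃ u : c.P →ₗ[R] c.P, u ∘ₗ (LinearMap.id + ε) = LinearMap.id := by
  have := c.finite
  have hs : Function.Surjective (LinearMap.id + ε : c.P →ₗ[R] c.P) := by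
    rw [← LinearMap.range_eq_top]
    refine c.superfluous _ (top_unique fun x _ => ?_)
    have hx : x = (LinearMap.id + ε : c.P →ₗ[R] c.P) x + -ε x := by simp
    have hk : ε x ∈ LinearMap.ker c.π := LinearMap.congr_fun hε x
    rw [hx]
    exact Submodule.add_mem_sup ⟨x, rfl⟩ (Submodule.neg_mem _ hk)
  let e := LinearEquiv.ofBijective _ (IsNoetherian.bijective_of_surjective_endomorphism _ hs)
  exact ⟨e.symm, LinearMap.ext fun x => e.symm_apply_apply x⟩

/-- `Hom_R(M, τ_d N) = 0` if and only if all maps from `Q₁` to `M` factor through `Q₁ ⟶ Q`, if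
`Q₁ ⟶ Q` is a presentation of the `(d-1)`-st syzygy of `N` such that no summand of `Q₁` maps to
zero. -/
theorem homTauVanishes_iff [Module.Finite k R] {d : ℕ} {M N : ModuleCat.{v} R} [Module.Finite R N]
    {Q₁ K' Q K : Type v} [AddCommGroup K'] [Module R K'] [AddCommGroup Q] [Module R Q]
    [AddCommGroup K] [Module R K] [AddCommGroup Q₁] [Module R Q₁]
    (h : haveI := isArtinianRing_of_finite (R := R) k
      StablyEquivalent R (iterSyzygy (d - 1) N).1 K)
    {κ : K' →ₗ[R] Q} {ρ : Q →ₗ[R] K} (hκ : Function.Injective κ) (hex : Function.Exact κ ρ)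
    (hρ : Function.Surjective ρ) [Module.Projective R Q]
    {q : Q₁ →ₗ[R] K'} (hq : Function.Surjective q) [Module.Projective R Q₁]
    (hQ : ∀ ε : Q₁ →ₗ[R] Q₁, q ∘ₗ ε = 0 → ∃ u : Q₁ →ₗ[R] Q₁,
      u ∘ₗ (LinearMap.id + ε) = LinearMap.id) :
    HomTauVanishes k d M N ↔ ∀ φ : Q₁ →ₗ[R] M, ∃ ψ : Q →ₗ[R] M, φ = ψ ∘ₗ κ ∘ₗ q := by
  have := isArtinianRing_of_finite (R := R) k
  have := (iterSyzygy (d - 1) N).2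
  let c := projCover (iterSyzygy (d - 1) N).1
  let c₁ := projCover (syzygy (iterSyzygy (d - 1) N).1)
  have := c.finite
  have := c.projective
  have := c₁.finite
  have := c₁.projective
  have key : HomTauVanishes k d M N ↔
      ∀ χ : c₁.P →ₗ[R] M, ∃ ψ : c.P →ₗ[R] M, χ = ψ ∘ₗ (LinearMap.ker c.π).subtype ∘ₗ c₁.π :=
    hom_ker_nakayamaMap_eq_zero_iff k (minPresentation (iterSyzygy (d - 1) N).1)
  rw [key]
  have hex0 : Function.Exact (LinearMap.ker c.π).subtype c.π := LinearMap.exact_subtype_ker_map _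
  constructor
  · intro H
    exact StablyEquivalent.factors_through_presentation (L' := LinearMap.ker c.π) h
      (Submodule.injective_subtype _) hex0 c.surjective hκ hex hρ c₁.surjective hq hQ H
  · intro H
    exact StablyEquivalent.factors_through_presentation (K' := LinearMap.ker c.π) h.symm hκ hex hρ
      (Submodule.injective_subtype _) hex0 c.surjective hq c₁.surjective c₁.exists_inverse H

/-- Allows syzygies to be computed, up to projectives, from any projective resolution in place of
the minimal one. -/
theorem stablyEquivalent_iterSyzygy_succ [IsArtinianRing R] {n : ℕ} {N : ModuleCat.{v} R}
    [Module.Finite R N] {K' Q K : Type v} [AddCommGroup K'] [Module R K'] [AddCommGroup Q]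
    [Module R Q] [AddCommGroup K] [Module R K] (h : StablyEquivalent R (iterSyzygy n N).1 K)
    {κ : K' →ₗ[R] Q} {ρ : Q →ₗ[R] K} (hκ : Function.Injective κ) (hex : Function.Exact κ ρ)
    (hρ : Function.Surjective ρ) [Module.Projective R Q] :
    StablyEquivalent R (iterSyzygy (n + 1) N).1 K' := by
  have := (iterSyzygy n N).2
  let c := projCover (iterSyzygy n N).1
  have := c.projective
  have key : StablyEquivalent R (LinearMap.ker c.π) K' :=
    h.syzygy (Submodule.injective_subtype _) (LinearMap.exact_subtype_ker_map _) c.surjective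
      hκ hex hρ
  have e : (iterSyzygy (n + 1) N).1 = ModuleCat.of R (LinearMap.ker c.π) := by
    rw [iterSyzygy, Function.iterate_succ_apply']; rfl
  rw [e]
  exact key

end Tau

/-! ## The functor `C(T, -)` on `add T` -/

section AddT

variable {C : Type u} [Category.{v} C] [Preadditive C] {T : C}

theorem exists_hom_eq {R : Type v} [Ring R] {M N : ModuleCat.{v} R} (f : M →ₗ[R] N) :
    ∃ g : M ⟶ N, g.hom = f :=
  ⟨ModuleCat.ofHom f, rfl⟩

theorem coyoneda_map_eq_zero_iff {X Y : C} (f : X ⟶ Y) :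
    (preadditiveCoyonedaObj T).map f = 0 ↔ ∀ x : T ⟶ X, x ≫ f = 0 := by
  constructor
  · intro h x
    have := LinearMap.congr_fun (congrArg ModuleCat.Hom.hom h) x
    exact this
  · intro h
    ext x
    exact h x

theorem IsFgProj.of_iso {R : Type v} [Ring R] {P Q : ModuleCat.{v} R} (e : P ≅ Q)
    (h : IsFgProj P) : IsFgProj Q := by
  have := h.1
  have := h.2
  exact ⟨Module.Finite.equiv e.toLinearEquiv, Module.Projective.of_equiv e.toLinearEquiv⟩

theorem IsFgProj.inAdd {P : ModuleCat.{v} (End T)ᵐᵒᵖ} (hP : IsFgProj P) :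
    InAdd ((preadditiveCoyonedaObj T).obj T) P := by
  have := hP.1
  have := hP.2
  obtain ⟨n, c, c', hc⟩ := exists_dualBasis (R := (End T)ᵐᵒᵖ) P
  let i : (End T)ᵐᵒᵖ →ₗ[(End T)ᵐᵒᵖ] (preadditiveCoyonedaObj T).obj T :=
    { toFun := fun r => r.unop
      map_add' := fun _ _ => rfl
      map_smul' := fun _ _ => rfl }
  let i' : (preadditiveCoyonedaObj T).obj T →ₗ[(End T)ᵐᵒᵖ] (End T)ᵐᵒᵖ :=
    { toFun := fun x => MulOpposite.op x
      map_add' := fun _ _ => rfl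
      map_smul' := fun _ _ => rfl }
  refine inAdd_iff.2 ⟨n, fun j => ModuleCat.ofHom (i ∘ₗ c' j),
    fun j => ModuleCat.ofHom (LinearMap.toSpanSingleton _ P (c j) ∘ₗ i'), ?_⟩
  ext x
  rw [ModuleCat.hom_sum, LinearMap.sum_apply]
  exact hc x

variable [HasFiniteBiproducts C]

theorem InAdd.eq_zero_of_comp {A : C} (hA : InAdd T A) {Y : C} (f : A ⟶ Y)
    (h : ∀ x : T ⟶ A, x ≫ f = 0) : f = 0 := by
  obtain ⟨n, u, v, huv⟩ := inAdd_iff.1 hA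
  rw [← Category.id_comp f, ← huv, Preadditive.sum_comp]
  exact Finset.sum_eq_zero fun j _ => by rw [Category.assoc, h, comp_zero]

theorem InAdd.eq_zero_of_comp' {A : C} (hA : InAdd T A) {Y : C} (f : Y ⟶ A)
    (h : ∀ x : A ⟶ T, f ≫ x = 0) : f = 0 := by
  obtain ⟨n, u, v, huv⟩ := inAdd_iff.1 hA
  rw [← Category.comp_id f, ← huv, Preadditive.comp_sum]
  exact Finset.sum_eq_zero fun j _ => by rw [← Category.assoc, h, zero_comp]

theorem InAdd.coyoneda_map_injective {A : C} (hA : InAdd T A) {Y : C} {f g : A ⟶ Y}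
    (h : (preadditiveCoyonedaObj T).map f = (preadditiveCoyonedaObj T).map g) : f = g := by
  rw [← sub_eq_zero]
  refine hA.eq_zero_of_comp _ ((coyoneda_map_eq_zero_iff _).1 ?_)
  rw [Functor.map_sub, h, sub_self]

theorem InAdd.exists_coyoneda_map_eq {A : C} (hA : InAdd T A) {Y : C}
    (φ : (preadditiveCoyonedaObj T).obj A ⟶ (preadditiveCoyonedaObj T).obj Y) :
    ∃ f : A ⟶ Y, (preadditiveCoyonedaObj T).map f = φ := by
  obtain ⟨n, u, v, huv⟩ := inAdd_iff.1 hA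
  let φ' : (T ⟶ A) → (T ⟶ Y) := fun x => φ.hom x
  have hφ (a : T ⟶ T) (x : T ⟶ A) : φ' (a ≫ x) = a ≫ φ' x :=
    φ.hom.map_smul (MulOpposite.op (a : End T)) x
  refine ⟨∑ j, u j ≫ φ' (v j), ?_⟩
  ext x
  change T ⟶ A at x
  change x ≫ ∑ j, u j ≫ φ' (v j) = φ' x
  have h1 : φ' x = φ' (∑ j, x ≫ u j ≫ v j) := by
    rw [← Preadditive.comp_sum, huv, Category.comp_id]
  have h2 : φ' (∑ j, x ≫ u j ≫ v j) = ∑ j, φ' (x ≫ u j ≫ v j) := map_sum φ.hom _ _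
  rw [h1, h2, Preadditive.comp_sum]
  refine Finset.sum_congr rfl fun j _ => ?_
  rw [← Category.assoc, ← Category.assoc, hφ]

theorem InAdd.isFgProj {A : C} (hA : InAdd T A) :
    IsFgProj ((preadditiveCoyonedaObj T).obj A) := by
  obtain ⟨n, u, v, huv⟩ := inAdd_iff.1 hA
  let i : (preadditiveCoyonedaObj T).obj A →ₗ[(End T)ᵐᵒᵖ] (Fin n → (End T)ᵐᵒᵖ) :=
    { toFun := fun x j => MulOpposite.op ((show T ⟶ A from x) ≫ u j : T ⟶ T)
      map_add' := fun x y => funext fun j =>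
        congrArg MulOpposite.op (Preadditive.add_comp _ _ _ _ _ _)
      map_smul' := fun r x => funext fun j =>
        congrArg MulOpposite.op (Category.assoc _ _ _) }
  let s : (Fin n → (End T)ᵐᵒᵖ) →ₗ[(End T)ᵐᵒᵖ] (preadditiveCoyonedaObj T).obj A :=
    { toFun := fun r => ∑ j, r j • (show (preadditiveCoyonedaObj T).obj A from v j)
      map_add' := fun r r' => by
        rw [← Finset.sum_add_distrib]
        exact Finset.sum_congr rfl fun j _ => add_smul _ _ _
      map_smul' := fun a r => by
        rw [Finset.smul_sum]
        exact Finset.sum_congr rfl fun j _ => mul_smul _ _ _ }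
  have hsi : s ∘ₗ i = LinearMap.id := by
    refine LinearMap.ext fun x => ?_
    change T ⟶ A at x
    change ∑ j, (x ≫ u j) ≫ v j = x
    simp only [Category.assoc]
    rw [← Preadditive.comp_sum, huv, Category.comp_id]
  refine ⟨Module.Finite.of_surjective s fun x => ⟨i x, LinearMap.congr_fun hsi x⟩,
    Module.Projective.of_split i s hsi⟩

/-- A projective is the image of an idempotent of `C(T, T^n)`. Full faithfulness on `add T` moves
the idempotent to `T^n`, where it splits. -/
theorem IsFgProj.exists_iso [IsIdempotentComplete C] {P : ModuleCat.{v} (End T)ᵐᵒᵖ}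
    (hP : IsFgProj P) :
    ∃ A : C, InAdd T A ∧ Nonempty (P ≅ (preadditiveCoyonedaObj T).obj A) := by
  obtain ⟨n, ⟨r⟩⟩ := hP.inAdd
  let F := preadditiveCoyonedaObj T
  let B : C := ⨁ fun _ : Fin n => T
  have hB : InAdd T B := ⟨n, ⟨Retract.refl _⟩⟩
  let e : F.obj B ≅ ⨁ fun _ : Fin n => F.obj T := F.mapBiproduct _
  let r' : Retract P (F.obj B) := r.trans (Retract.ofIso e.symm)
  obtain ⟨p, hp⟩ := hB.exists_coyoneda_map_eq (r'.r ≫ r'.i)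
  have hpp : p ≫ p = p := hB.coyoneda_map_injective (by
    rw [Functor.map_comp, hp]; simp)
  obtain ⟨A, i, q, h1, h2⟩ := IsIdempotentComplete.idempotents_split B p hpp
  refine ⟨A, hB.of_retract ⟨i, q, h1⟩, ⟨⟨r'.i ≫ F.map q, F.map i ≫ r'.r, ?_, ?_⟩⟩⟩
  · have : F.map q ≫ F.map i = r'.r ≫ r'.i := by rw [← F.map_comp, h2, hp]
    rw [Category.assoc, ← Category.assoc (F.map q), this]
    simp
  · rw [Category.assoc, ← Category.assoc r'.r, ← hp, ← h2]
    change F.map i ≫ F.map (q ≫ i) ≫ F.map q = _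
    rw [← F.map_comp, ← F.map_comp, ← F.map_id]
    congr 1
    rw [Category.assoc, h1, Category.comp_id, h1]

theorem inAdd_of_isIso_sum {ι : Type*} [Fintype ι] {X Y : C} (u : ι → (Y ⟶ X)) (v : ι → (X ⟶ Y))
    (h : IsIso (∑ j, u j ≫ v j)) : InAdd X Y :=
  inAdd_of_finset (fun j => inv (∑ j, u j ≫ v j) ≫ u j) v (by
    simp only [Category.assoc]
    rw [← Preadditive.comp_sum, IsIso.inv_hom_id])

theorem inAdd_coyoneda_iff_of_inAdd {A B : C} (hA : InAdd T A) (hB : InAdd T B) :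
    InAdd ((preadditiveCoyonedaObj T).obj A) ((preadditiveCoyonedaObj T).obj B) ↔
      InAdd A B := by
  refine ⟨fun h => ?_, fun h => h.map _⟩
  obtain ⟨n, u, v, huv⟩ := inAdd_iff.1 h
  choose u' hu' using fun j => hB.exists_coyoneda_map_eq (u j)
  choose v' hv' using fun j => hA.exists_coyoneda_map_eq (v j)
  refine inAdd_iff.2 ⟨n, u', v', hB.coyoneda_map_injective ?_⟩
  rw [Functor.map_sum, CategoryTheory.Functor.map_id, ← huv]
  simp only [Functor.map_comp, hu', hv']

theorem nonempty_iso_of_inAdd {A B : C} (hA : InAdd T A) (hB : InAdd T B)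
    (e : (preadditiveCoyonedaObj T).obj A ≅ (preadditiveCoyonedaObj T).obj B) :
    Nonempty (A ≅ B) := by
  obtain ⟨f, hf⟩ := hA.exists_coyoneda_map_eq e.hom
  obtain ⟨g, hg⟩ := hB.exists_coyoneda_map_eq e.inv
  exact ⟨⟨f, g,
    hA.coyoneda_map_injective (by rw [Functor.map_comp, hf, hg, e.hom_inv_id, CategoryTheory.Functor.map_id]),
    hB.coyoneda_map_injective (by rw [Functor.map_comp, hf, hg, e.inv_hom_id, CategoryTheory.Functor.map_id])⟩⟩

end AddT

/-! ## The functor `C(T, -)` for a cluster tilting object `T` -/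

section ClusterTilting

variable {C : Type u} [Category.{v} C] [Preadditive C] [HasFiniteBiproducts C]
  {S : C ≌ C} {T : C}

/-- The object `X` has no non-zero direct summand in `add U`. -/
def NoSummand (U X : C) : Prop :=
  ∀ Z : C, InAdd U Z → Nonempty (Retract Z X) → IsZero Z

theorem IsRigid.eq_zero (hT : IsRigid S T) {A W : C} (hA : InAdd T A)
    (hW : InAdd (S.functor.obj T) W) (f : A ⟶ W) : f = 0 :=
  hA.eq_zero_of_comp _ fun _ => hW.eq_zero_of_comp' _ fun _ => hT _

theorem IsRigid.coyoneda_map_eq_zero (hT : IsRigid S T) {X Y W : C}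
    (hW : InAdd (S.functor.obj T) W) (p : X ⟶ W) (q : W ⟶ Y) :
    (preadditiveCoyonedaObj T).map (p ≫ q) = 0 := by
  rw [coyoneda_map_eq_zero_iff]
  intro x
  rw [← Category.assoc, hT.eq_zero (InAdd.refl T) hW (x ≫ p), zero_comp]

variable [HasBinaryBiproducts C] [S.functor.Additive] {m : ℕ} {𝒜 : Angulation (m + 1) S}

/-- The right end of the angle `T_d ⟶ ⋯ ⟶ T_0 ⟶ Y ⟶ S T_d`, with `U = S T_d`. Maps `T ⟶ Y` lift to
`T_0` because `C(T, S T_d) = 0`. -/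
theorem Angulation.IsClusterTilting.exists_presentation (hT : 𝒜.IsClusterTilting T) (Y : C) :
    ∃ (T₁ T₀ U : C) (a : T₁ ⟶ T₀) (t : T₀ ⟶ Y) (c : Y ⟶ U), InAdd T T₁ ∧ InAdd T T₀ ∧
      InAdd (S.functor.obj T) U ∧ a ≫ t = 0 ∧
      (∀ {W : C} (f : T₀ ⟶ W), a ≫ f = 0 → ∃ g, t ≫ g = f) ∧
      (∀ {W : C} (f : Y ⟶ W), t ≫ f = 0 → ∃ g, c ≫ g = f) ∧
      ∀ x : T ⟶ Y, ∃ y, y ≫ t = x := by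
  obtain ⟨A, hA, ⟨e⟩, hAT⟩ := hT.2 Y
  have hU : InAdd (S.functor.obj T) (S.functor.obj (A.obj (Fin.last (m + 2)))) :=
    (hAT (Fin.last (m + 1))).map S.functor
  let α₁ : A.obj 2 ⟶ A.obj 1 := A.map 1
  let α₀ : A.obj 1 ⟶ A.obj 0 := A.map 0
  refine ⟨A.obj 2, A.obj 1, S.functor.obj (A.obj (Fin.last (m + 2))), α₁, α₀ ≫ e.hom,
    e.inv ≫ A.conn, hAT 1, hAT 0, hU, ?_, ?_, ?_, ?_⟩
  · have : α₁ ≫ α₀ = 0 := 𝒜.isAngle_comp 0 m.succ_pos hA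
    rw [← Category.assoc, this, zero_comp]
  · intro W f hf
    obtain ⟨g, hg⟩ : ∃ g : A.obj 0 ⟶ W, α₀ ≫ g = f := 𝒜.exists_desc 0 m.succ_pos hA f hf
    exact ⟨e.inv ≫ g, by rw [Category.assoc, e.hom_inv_id_assoc, hg]⟩
  · intro W f hf
    obtain ⟨g, hg⟩ := 𝒜.exists_desc_conn hA (e.hom ≫ f) ((Category.assoc α₀ _ _).symm.trans hf)
    exact ⟨g, by rw [Category.assoc, hg, e.inv_hom_id_assoc]⟩
  · intro x
    obtain ⟨g, hg⟩ : ∃ g : T ⟶ A.obj 1, g ≫ α₀ = x ≫ e.inv :=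
      𝒜.exists_lift_conn hA (x ≫ e.inv) (hT.1.eq_zero (InAdd.refl T) hU _)
    exact ⟨g, by rw [← Category.assoc, hg, Category.assoc, e.inv_hom_id, Category.comp_id]⟩

/-- Fullness: the restriction of `φ` to `C(T, T_0)` comes from a morphism `T_0 ⟶ Y` that vanishes on
`T_1`, hence descends to `X`. -/
theorem Angulation.IsClusterTilting.exists_coyoneda_map_eq (hT : 𝒜.IsClusterTilting T) {X Y : C}
    (φ : (preadditiveCoyonedaObj T).obj X ⟶ (preadditiveCoyonedaObj T).obj Y) :
    ∃ f : X ⟶ Y, (preadditiveCoyonedaObj T).map f = φ := by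
  obtain ⟨T₁, T₀, U, a, t, c, h₁, h₀, -, hat, hdesc, -, hlift⟩ := hT.exists_presentation X
  obtain ⟨g, hg⟩ := h₀.exists_coyoneda_map_eq ((preadditiveCoyonedaObj T).map t ≫ φ)
  obtain ⟨f, hf⟩ := hdesc g (h₁.coyoneda_map_injective (by
    rw [Functor.map_comp, hg, ← Category.assoc, ← Functor.map_comp, hat, Functor.map_zero,
      Functor.map_zero, zero_comp]))
  refine ⟨f, ?_⟩
  rw [← hf, Functor.map_comp] at hg
  ext x
  obtain ⟨y, rfl⟩ := hlift x
  exact LinearMap.congr_fun (congrArg ModuleCat.Hom.hom hg) y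

/-- A morphism killed by `C(T, -)` vanishes on `T_0`, so it factors through `X ⟶ S T_d`. -/
theorem Angulation.IsClusterTilting.exists_factor (hT : 𝒜.IsClusterTilting T) {X Y : C}
    {f : X ⟶ Y} (hf : (preadditiveCoyonedaObj T).map f = 0) :
    ∃ (W : C) (p : X ⟶ W) (q : W ⟶ Y), InAdd (S.functor.obj T) W ∧ p ≫ q = f := by
  obtain ⟨T₁, T₀, U, a, t, c, h₁, h₀, hU, hat, -, hdesc, -⟩ := hT.exists_presentation X
  obtain ⟨g, hg⟩ := hdesc f (h₀.eq_zero_of_comp _ fun x => by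
    rw [← Category.assoc]
    exact (coyoneda_map_eq_zero_iff f).1 hf _)
  exact ⟨U, c, g, hU, hg⟩

/-- Under `C(T, -)` the angle becomes a projective resolution of `N` with last term `C(T, T_d)`,
whose images are the syzygies. Since `obj i.succ` is `T_i`, the `n`-th syzygy is the image of the
arrow of index `n`. -/
theorem Angulation.IsClusterTilting.stablyEquivalent_iterSyzygy
    (k : Type w) [Field k] [Linear k C] [∀ X Y : C, Module.Finite k (X ⟶ Y)]
    (hT : 𝒜.IsClusterTilting T) {A : SSeq (m + 1) S} (hA : 𝒜.IsAngle A)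
    (hAT : ∀ i : Fin (m + 2), InAdd T (A.obj i.succ)) {N : ModuleCat.{v} (End T)ᵐᵒᵖ}
    [Module.Finite (End T)ᵐᵒᵖ N] (e : N ≅ (preadditiveCoyonedaObj T).obj (A.obj 0))
    (n : ℕ) (hn : n < m + 2) :
    haveI := isArtinianRing_of_finite (R := (End T)ᵐᵒᵖ) k
    StablyEquivalent (End T)ᵐᵒᵖ (iterSyzygy n N).1
      (LinearMap.range ((preadditiveCoyonedaObj T).map (A.map ⟨n, hn⟩)).hom) := by
  have := isArtinianRing_of_finite (R := (End T)ᵐᵒᵖ) k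
  induction n with
  | zero =>
    refine StablyEquivalent.of_equiv (e.toLinearEquiv.trans (LinearEquiv.ofTop _ ?_).symm)
    refine LinearMap.range_eq_top.2 fun x => ?_
    exact 𝒜.exists_lift_conn hA (show T ⟶ A.obj 0 from x)
      (hT.1.eq_zero (InAdd.refl T) ((hAT (Fin.last (m + 1))).map S.functor) _)
  | succ n ih =>
    have hn' : n < m + 1 := by omega
    have hproj : Module.Projective (End T)ᵐᵒᵖ
        ((preadditiveCoyonedaObj T).obj (A.obj (Fin.castSucc ⟨n, hn'⟩).succ)) :=
      (hAT (Fin.castSucc ⟨n, hn'⟩)).isFgProj.2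
    refine stablyEquivalent_iterSyzygy_succ
      (K' := LinearMap.range ((preadditiveCoyonedaObj T).map (A.map (Fin.succ ⟨n, hn'⟩))).hom)
      (Q := (preadditiveCoyonedaObj T).obj (A.obj (Fin.castSucc ⟨n, hn'⟩).succ))
      (ih (by omega)) (κ := Submodule.subtype _)
      (ρ := ((preadditiveCoyonedaObj T).map (A.map (Fin.castSucc ⟨n, hn'⟩))).hom.rangeRestrict)
      (Submodule.injective_subtype _) ?_ (LinearMap.surjective_rangeRestrict _)
    intro x
    constructor
    · intro hx
      obtain ⟨g, hg⟩ := 𝒜.exists_lift n hn' hA (show T ⟶ _ from x) (congrArg Subtype.val hx)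
      exact ⟨⟨x, g, hg⟩, rfl⟩
    · rintro ⟨⟨_, g, rfl⟩, rfl⟩
      refine Subtype.ext ?_
      change ((show T ⟶ _ from g) ≫ A.map (Fin.succ ⟨n, hn'⟩)) ≫ A.map (Fin.castSucc ⟨n, hn'⟩) = 0
      have h0 := 𝒜.isAngle_comp n hn' hA
      exact (Category.assoc _ _ _).trans ((congrArg _ h0).trans comp_zero)

variable [IsIdempotentComplete C]

theorem Angulation.IsClusterTilting.isIso_of_coyoneda_map_eq_id
    (k : Type w) [Field k] [Linear k C] [∀ X Y : C, Module.Finite k (X ⟶ Y)]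
    (hT : 𝒜.IsClusterTilting T) {X : C} (hX : NoSummand (S.functor.obj T) X) {f : X ⟶ X}
    (hf : (preadditiveCoyonedaObj T).map f = 𝟙 _) : IsIso f := by
  obtain ⟨W, p, q, hW, hpq⟩ := hT.exists_factor (f := 𝟙 X - f) (by
    rw [Functor.map_sub, hf, CategoryTheory.Functor.map_id, sub_self])
  have := isIso_one_sub_of_factors k
    (fun Z h ⟨r⟩ => hX Z (hW.of_retract r) h) p q
  rw [hpq] at this
  simpa using this

theorem Angulation.IsClusterTilting.nonempty_iso
    (k : Type w) [Field k] [Linear k C] [∀ X Y : C, Module.Finite k (X ⟶ Y)]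
    (hT : 𝒜.IsClusterTilting T) {X Y : C} (hX : NoSummand (S.functor.obj T) X)
    (hY : NoSummand (S.functor.obj T) Y)
    (e : (preadditiveCoyonedaObj T).obj X ≅ (preadditiveCoyonedaObj T).obj Y) :
    Nonempty (X ≅ Y) := by
  obtain ⟨f, hf⟩ := hT.exists_coyoneda_map_eq e.hom
  obtain ⟨g, hg⟩ := hT.exists_coyoneda_map_eq e.inv
  have h1 : IsIso (f ≫ g) := hT.isIso_of_coyoneda_map_eq_id k hX (by
    rw [Functor.map_comp, hf, hg, e.hom_inv_id])
  have h2 : IsIso (g ≫ f) := hT.isIso_of_coyoneda_map_eq_id k hY (by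
    rw [Functor.map_comp, hf, hg, e.inv_hom_id])
  have hm : IsSplitMono f := ⟨⟨⟨g ≫ inv (f ≫ g), by rw [← Category.assoc, IsIso.hom_inv_id]⟩⟩⟩
  have he : IsSplitEpi f := ⟨⟨⟨inv (g ≫ f) ≫ g, by rw [Category.assoc, IsIso.inv_hom_id]⟩⟩⟩
  have : IsIso f := isIso_of_epi_of_isSplitMono f
  exact ⟨asIso f⟩

/-- Only `Y` must be free of summands in `add (S T)`: the lifted splitting of `C(T, Y)` is an
automorphism of `Y` rather than the identity, which is enough. -/
theorem Angulation.IsClusterTilting.inAdd_coyoneda_iff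
    (k : Type w) [Field k] [Linear k C] [∀ X Y : C, Module.Finite k (X ⟶ Y)]
    (hT : 𝒜.IsClusterTilting T) {X Y : C} (hY : NoSummand (S.functor.obj T) Y) :
    InAdd ((preadditiveCoyonedaObj T).obj X) ((preadditiveCoyonedaObj T).obj Y) ↔
      InAdd X Y := by
  refine ⟨fun h => ?_, fun h => h.map _⟩
  obtain ⟨n, u, v, huv⟩ := inAdd_iff.1 h
  choose u' hu' using fun j => hT.exists_coyoneda_map_eq (u j)
  choose v' hv' using fun j => hT.exists_coyoneda_map_eq (v j)
  refine inAdd_of_isIso_sum u' v' (hT.isIso_of_coyoneda_map_eq_id k hY ?_)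
  rw [Functor.map_sum, ← huv]
  simp only [Functor.map_comp, hu', hv']

/-! ## Homomorphisms into `τ_d` -/

/-- For `Y` without summands in `add S T`: we have `Hom(C(T, X), τ_d C(T, Y)) = 0` if and only if all
morphisms `Y ⟶ S X` factoring through `add S T` are zero. -/
theorem Angulation.IsClusterTilting.homTauVanishes_iff
    (k : Type w) [Field k] [Linear k C] [∀ X Y : C, Module.Finite k (X ⟶ Y)]
    (hT : 𝒜.IsClusterTilting T) {X Y : C} (hY : NoSummand (S.functor.obj T) Y)
    {M N : ModuleCat.{v} (End T)ᵐᵒᵖ} [Module.Finite (End T)ᵐᵒᵖ N]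
    (eM : M ≅ (preadditiveCoyonedaObj T).obj X) (eN : N ≅ (preadditiveCoyonedaObj T).obj Y) :
    HomTauVanishes k (m + 1) M N ↔
      ∀ W : C, InAdd (S.functor.obj T) W → ∀ (f : Y ⟶ W) (g : W ⟶ S.functor.obj X),
        f ≫ g = 0 := by
  obtain ⟨A, hA, ⟨e⟩, hAT⟩ := hT.2 Y
  have hsyz := hT.stablyEquivalent_iterSyzygy k hA hAT
    (eN ≪≫ (preadditiveCoyonedaObj T).mapIso e.symm) m (by omega)
  have hproj (i : Fin (m + 2)) : Module.Projective (End T)ᵐᵒᵖ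
      ((preadditiveCoyonedaObj T).obj (A.obj i.succ)) := (hAT i).isFgProj.2
  let α : A.obj (Fin.last (m + 2)) ⟶ A.obj (Fin.last m).castSucc.succ := A.map (Fin.last (m + 1))
  have hTd : InAdd T (A.obj (Fin.last (m + 2))) := hAT (Fin.last (m + 1))
  have hTd' : InAdd T (A.obj (Fin.last m).castSucc.succ) := hAT (Fin.last m).castSucc
  have hU : InAdd (S.functor.obj T) (S.functor.obj (A.obj (Fin.last (m + 2)))) :=
    hTd.map S.functor
  have hp1 : Module.Projective (End T)ᵐᵒᵖ
      ((preadditiveCoyonedaObj T).obj (A.obj (Fin.last (m + 2)))) := hproj (Fin.last (m + 1))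
  have hp0 : Module.Projective (End T)ᵐᵒᵖ
      ((preadditiveCoyonedaObj T).obj (A.obj (Fin.last m).castSucc.succ)) :=
    hproj (Fin.last m).castSucc
  have key : HomTauVanishes k (m + 1) M N ↔
      ∀ φ : (preadditiveCoyonedaObj T).obj (A.obj (Fin.last (m + 2))) →ₗ[(End T)ᵐᵒᵖ] M,
        ∃ ψ : (preadditiveCoyonedaObj T).obj (A.obj (Fin.last m).castSucc.succ) →ₗ[(End T)ᵐᵒᵖ] M,
          φ = ψ ∘ₗ (LinearMap.range ((preadditiveCoyonedaObj T).map α).hom).subtype ∘ₗ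
            ((preadditiveCoyonedaObj T).map α).hom.rangeRestrict := by
    refine HigherAngulated.homTauVanishes_iff k hsyz
      (κ := (LinearMap.range ((preadditiveCoyonedaObj T).map α).hom).subtype)
      (ρ := ((preadditiveCoyonedaObj T).map (A.map (Fin.last m).castSucc)).hom.rangeRestrict)
      (Submodule.injective_subtype _) ?_ (LinearMap.surjective_rangeRestrict _)
      (LinearMap.surjective_rangeRestrict _) ?_
    · intro x
      constructor
      · intro hx
        obtain ⟨g, hg⟩ := 𝒜.exists_lift_last hA (show T ⟶ _ from x) (congrArg Subtype.val hx)
        exact ⟨⟨x, g, hg⟩, rfl⟩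
      · rintro ⟨⟨_, g, rfl⟩, rfl⟩
        refine Subtype.ext ?_
        have h0 := 𝒜.isAngle_comp_last hA
        exact (Category.assoc _ _ _).trans ((congrArg _ h0).trans comp_zero)
    · intro ε hε
      obtain ⟨ε, rfl⟩ := exists_hom_eq ε
      obtain ⟨b, rfl⟩ := hTd.exists_coyoneda_map_eq ε
      have hbα : b ≫ α = 0 := hTd.eq_zero_of_comp _ fun x => by
        rw [← Category.assoc]
        exact congrArg Subtype.val (LinearMap.congr_fun hε x)
      -- Since `b ≫ α = 0`, exactness makes `S b` factor through `Y`. No summand of `S T_d` is a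
      -- summand of `Y`, so `1 + b` is invertible. Here the assumption on `Y` replaces minimality of
      -- the resolution.
      obtain ⟨g, hg⟩ := 𝒜.exists_lift_susp hA (S.functor.map b) (by
        have : S.functor.map (b ≫ α) = 0 := by rw [hbα, S.functor.map_zero]
        rw [S.functor.map_comp] at this
        exact this)
      have hiso := isIso_one_sub_of_factors k
        (X := S.functor.obj (A.obj (Fin.last (m + 2)))) (W := A.obj 0)
        (fun Z ⟨r⟩ ⟨r'⟩ => hY Z (hU.of_retract r) ⟨r'.trans (Retract.ofIso e)⟩) (-g) A.conn
      rw [Preadditive.neg_comp, hg, sub_neg_eq_add, ← S.functor.map_id, ← S.functor.map_add] at hiso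
      have hiso' : IsIso (𝟙 _ + b) := isIso_of_reflects_iso _ S.functor
      refine ⟨((preadditiveCoyonedaObj T).map (inv (𝟙 _ + b))).hom, ?_⟩
      have h3 : LinearMap.id + ((preadditiveCoyonedaObj T).map b).hom =
          ((preadditiveCoyonedaObj T).map (𝟙 _ + b)).hom := by
        rw [Functor.map_add, CategoryTheory.Functor.map_id, ModuleCat.hom_add, ModuleCat.hom_id]
      rw [h3, ← ModuleCat.hom_comp, ← Functor.map_comp, IsIso.hom_inv_id, CategoryTheory.Functor.map_id]
      rfl
  rw [key]
  have key2 : (∀ φ : (preadditiveCoyonedaObj T).obj (A.obj (Fin.last (m + 2))) →ₗ[(End T)ᵐᵒᵖ] M,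
        ∃ ψ : (preadditiveCoyonedaObj T).obj (A.obj (Fin.last m).castSucc.succ) →ₗ[(End T)ᵐᵒᵖ] M,
          φ = ψ ∘ₗ (LinearMap.range ((preadditiveCoyonedaObj T).map α).hom).subtype ∘ₗ
            ((preadditiveCoyonedaObj T).map α).hom.rangeRestrict) ↔
      ∀ φ : A.obj (Fin.last (m + 2)) ⟶ X, ∃ ψ, α ≫ ψ = φ := by
    have hα : (LinearMap.range ((preadditiveCoyonedaObj T).map α).hom).subtype ∘ₗ
            ((preadditiveCoyonedaObj T).map α).hom.rangeRestrict =
        ((preadditiveCoyonedaObj T).map α).hom := rfl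
    rw [hα]
    constructor
    · intro H φ
      obtain ⟨ψ, hψ⟩ := H ((preadditiveCoyonedaObj T).map φ ≫ eM.inv).hom
      obtain ⟨ψ, rfl⟩ := exists_hom_eq ψ
      obtain ⟨ψ', hψ'⟩ := hTd'.exists_coyoneda_map_eq (ψ ≫ eM.hom)
      refine ⟨ψ', hTd.coyoneda_map_injective ?_⟩
      have h1 : (preadditiveCoyonedaObj T).map φ ≫ eM.inv =
        (preadditiveCoyonedaObj T).map α ≫ ψ := ModuleCat.hom_ext hψ
      rw [Functor.map_comp, hψ', ← Category.assoc, ← h1, Category.assoc, eM.inv_hom_id,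
        Category.comp_id]
    · intro H φ
      obtain ⟨φ, rfl⟩ := exists_hom_eq φ
      obtain ⟨φ', hφ'⟩ := hTd.exists_coyoneda_map_eq (φ ≫ eM.hom)
      obtain ⟨ψ, hψ⟩ := H φ'
      refine ⟨((preadditiveCoyonedaObj T).map ψ ≫ eM.inv).hom, ?_⟩
      have h1 : φ = (preadditiveCoyonedaObj T).map α ≫
          (preadditiveCoyonedaObj T).map ψ ≫ eM.inv := by
        rw [← Category.assoc, ← Functor.map_comp, hψ, hφ', Category.assoc, eM.hom_inv_id,
          Category.comp_id]
      exact congrArg ModuleCat.Hom.hom h1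
  rw [key2]
  constructor
  · intro H W hW f g
    -- As `C(T_0, W) = 0`, `f` factors through `Y ⟶ S T_d`. The resulting `S T_d ⟶ S X` factors
    -- through `S α` by assumption, and `S α` composes to zero with `Y ⟶ S T_d`.
    obtain ⟨f', hf'⟩ := 𝒜.exists_desc_conn hA (e.hom ≫ f) (hT.1.eq_zero (hAT 0) hW _)
    obtain ⟨ψ, hψ⟩ := H (S.functor.preimage (f' ≫ g))
    have h1 : f' ≫ g = S.functor.map α ≫ S.functor.map ψ := by
      rw [← S.functor.map_comp, hψ, S.functor.map_preimage]
    have h2 : A.conn ≫ S.functor.map α = 0 := 𝒜.conn_comp_map hA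
    have h3 : e.hom ≫ f ≫ g = 0 := by
      rw [← Category.assoc, ← hf', Category.assoc, h1, ← Category.assoc, h2, zero_comp]
    simpa using congrArg (fun t => e.inv ≫ t) h3
  · intro H φ
    obtain ⟨g, hg⟩ := 𝒜.exists_desc_susp hA (S.functor.map φ) (by
      have := H _ hU (e.inv ≫ A.conn) (S.functor.map φ)
      simpa using congrArg (fun t => e.hom ≫ t) this)
    refine ⟨S.functor.preimage g, S.functor.map_injective ?_⟩
    rw [S.functor.map_comp, S.functor.map_preimage]
    exact hg

end ClusterTilting

/-! ## `Ext^d` and maximal `d`-rigid objects -/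

section Ext

variable {C : Type u} [Category.{v} C] [Preadditive C] {S : C ≌ C}

theorem CalabiYau.eq_zero {k : Type w} [Field k] [Linear k C] (c : CalabiYau k S) {X Y : C}
    (f : X ⟶ Y) (h : ∀ t, c.equiv X Y f t = 0) : f = 0 :=
  (c.equiv X Y).map_eq_zero_iff.1 (LinearMap.ext h)

/-- `C(Y, S X)` is dual to `C(S X, S² Y) ≅ C(X, S Y)`. -/
theorem CalabiYau.extVanishes_symm {k : Type w} [Field k] [Linear k C] [S.functor.Additive]
    (c : CalabiYau k S) {X Y : C} (h : ExtVanishes S X Y) : ExtVanishes S Y X := by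
  refine fun f => c.eq_zero f fun t => ?_
  have : t = 0 := by
    rw [← S.functor.map_preimage t, h (S.functor.preimage t), S.functor.map_zero]
  rw [this, map_zero]

/-- Under the duality, precomposition with `p` is dual to postcomposition with `S² p`. -/
theorem CalabiYau.comp_eq_zero {k : Type w} [Field k] [Linear k C] (c : CalabiYau k S)
    {X X' Y : C} (p : X' ⟶ X) (f : X ⟶ Y)
    (h : ∀ t : Y ⟶ S.functor.obj (S.functor.obj X'),
      t ≫ S.functor.map (S.functor.map p) = 0) : p ≫ f = 0 := by
  refine c.eq_zero _ fun t => ?_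
  have := c.naturality p f (𝟙 Y) t
  rw [Category.comp_id, Category.id_comp, h, map_zero] at this
  exact this

theorem extVanishes_functor_obj_iff [S.functor.Additive] {X Y : C} :
    ExtVanishes S (S.functor.obj X) Y ↔ ∀ f : X ⟶ Y, f = 0 := by
  constructor
  · intro h f
    exact S.functor.map_injective ((h (S.functor.map f)).trans (S.functor.map_zero _ _).symm)
  · intro h f
    rw [← S.functor.map_preimage f, h (S.functor.preimage f), S.functor.map_zero]

theorem ExtVanishes.of_iso_right {X Y Y' : C} (h : ExtVanishes S X Y)
    (e : Y ≅ Y') : ExtVanishes S X Y' := fun f => by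
  have h1 := h (f ≫ S.functor.map e.inv)
  have h2 : (f ≫ S.functor.map e.inv) ≫ S.functor.map e.hom = f := by
    rw [Category.assoc, ← S.functor.map_comp, e.inv_hom_id, S.functor.map_id, Category.comp_id]
  rw [← h2, h1, zero_comp]

theorem ExtVanishes.of_iso_left {X X' Y : C} (h : ExtVanishes S X Y)
    (e : X ≅ X') : ExtVanishes S X' Y := fun f => by
  rw [← e.inv_hom_id_assoc f, h (e.hom ≫ f), comp_zero]

variable [HasFiniteBiproducts C]

theorem ExtVanishes.of_inAdd_left {X X' Y : C} (h : ExtVanishes S X Y) (hX : InAdd X X') :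
    ExtVanishes S X' Y :=
  fun f => hX.eq_zero_of_comp f fun _ => h _

theorem ExtVanishes.of_inAdd_right [S.functor.Additive] {X Y Y' : C} (h : ExtVanishes S X Y)
    (hY : InAdd Y Y') : ExtVanishes S X Y' :=
  fun f => (hY.map S.functor).eq_zero_of_comp' f fun _ => h _

variable [HasBinaryBiproducts C]

theorem extVanishes_biprod_left_iff {X X' Y : C} :
    ExtVanishes S (X ⊞ X') Y ↔ ExtVanishes S X Y ∧ ExtVanishes S X' Y := by
  constructor
  · intro h
    exact ⟨h.of_inAdd_left ((InAdd.refl _).of_retract (retractInl X X')),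
      h.of_inAdd_left ((InAdd.refl _).of_retract (retractInr X X'))⟩
  · intro h f
    ext
    · rw [h.1 (biprod.inl ≫ f), comp_zero]
    · rw [h.2 (biprod.inr ≫ f), comp_zero]

theorem CalabiYau.extVanishes_biprod_right {k : Type w} [Field k] [Linear k C]
    [S.functor.Additive] (c : CalabiYau k S) {X Y Y' : C} (h : ExtVanishes S X Y)
    (h' : ExtVanishes S X Y') : ExtVanishes S X (Y ⊞ Y') :=
  c.extVanishes_symm
    (extVanishes_biprod_left_iff.2 ⟨c.extVanishes_symm h, c.extVanishes_symm h'⟩)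

/-- If all indecomposable objects are `d`-rigid, then `X` is maximal `d`-rigid if and only if
`add X` consists of the objects `Y` with `Ext^d(X, Y) = 0`. -/
theorem CalabiYau.isMaximalRigid_iff {k : Type w} [Field k] [Linear k C]
    [∀ X Y : C, Module.Finite k (X ⟶ Y)] [S.functor.Additive] (c : CalabiYau k S)
    (hrigid : ∀ X : C, Indecomposable X → IsRigid S X) (X : C) :
    IsMaximalRigid S X ↔ ∀ Y : C, InAdd X Y ↔ ExtVanishes S X Y := by
  constructor
  · intro h Y
    have hr : InAdd (X ⊞ X) X := (InAdd.refl _).of_retract (retractInl X X)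
    have hX : ExtVanishes S X X :=
      (((h X).1 (InAdd.refl X)).of_inAdd_left hr).of_inAdd_right hr
    constructor
    · exact fun hY => hX.of_inAdd_right hY
    · refine induction_on_indecomposable k (P := fun Y => ExtVanishes S X Y → InAdd X Y)
        (fun Z hZ _ => InAdd.of_isZero X hZ) (fun Z hZ hXZ => ?_) (fun Z Z₁ Z₂ e h₁ h₂ hXZ => ?_) Y
      · exact (h Z).2 (extVanishes_biprod_left_iff.2 ⟨c.extVanishes_biprod_right hX hXZ,
          c.extVanishes_biprod_right (c.extVanishes_symm hXZ) (hrigid Z hZ)⟩)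
      · have h' := hXZ.of_iso_right e
        exact ((h₁ (h'.of_inAdd_right ((InAdd.refl _).of_retract (retractInl _ _)))).biprod
          (h₂ (h'.of_inAdd_right ((InAdd.refl _).of_retract (retractInr _ _))))).of_retract
          (Retract.ofIso e)
  · intro h Y
    constructor
    · intro hY
      have hXX : ExtVanishes S X X := (h X).1 (InAdd.refl X)
      have hXY : InAdd X (X ⊞ Y) := (InAdd.refl X).biprod hY
      exact (hXX.of_inAdd_left hXY).of_inAdd_right hXY
    · intro hY
      exact (h Y).2 ((hY.of_inAdd_left ((InAdd.refl _).of_retract (retractInl _ _))).of_inAdd_right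
        ((InAdd.refl _).of_retract (retractInr _ _)))

end Ext

/-! ### Cancelling a summand in additive closures -/

section Add

variable {C : Type u} [Category.{v} C] [Preadditive C] [IsIdempotentComplete C]

theorem isIso_one_sub_sum_of_factors (k : Type w) [Field k] [Linear k C]
    [∀ X Y : C, Module.Finite k (X ⟶ Y)] {ι : Type*} (s : Finset ι) {X W : C}
    (h : ∀ Z : C, Nonempty (Retract Z X) → Nonempty (Retract Z W) → IsZero Z)
    (p : ι → (X ⟶ W)) (q : ι → (W ⟶ X)) : IsIso (𝟙 X - ∑ j ∈ s, p j ≫ q j) := by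
  classical
  induction s using Finset.induction_on with
  | empty => simp only [Finset.sum_empty, sub_zero]; infer_instance
  | insert a s ha ih =>
    have h1 := isIso_one_sub_of_factors k h (inv (𝟙 X - ∑ j ∈ s, p j ≫ q j) ≫ p a) (q a)
    have h2 : 𝟙 X - ∑ j ∈ insert a s, p j ≫ q j = (𝟙 X - ∑ j ∈ s, p j ≫ q j) ≫
        (𝟙 X - (inv (𝟙 X - ∑ j ∈ s, p j ≫ q j) ≫ p a) ≫ q a) := by
      rw [Preadditive.comp_sub, Category.assoc, IsIso.hom_inv_id_assoc, Category.comp_id,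
        Finset.sum_insert ha]
      abel
    rw [h2]
    infer_instance

/-- In a splitting of `Z` through copies of `X' ⊞ X''`, the part through `X'` can be removed: what
remains is still an automorphism of `Z`. -/
theorem InAdd.of_biprod [HasBinaryBiproducts C] [HasFiniteBiproducts C]
    (k : Type w) [Field k] [Linear k C]
    [∀ X Y : C, Module.Finite k (X ⟶ Y)] {X' X'' Z : C} (hZ : InAdd (X' ⊞ X'') Z)
    (h : ∀ A : C, Nonempty (Retract A Z) → Nonempty (Retract A X') → IsZero A) :
    InAdd X'' Z := by
  obtain ⟨n, u, v, huv⟩ := inAdd_iff.1 hZ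
  refine inAdd_of_isIso_sum (fun j => u j ≫ biprod.snd) (fun j => biprod.inr ≫ v j) ?_
  have key := isIso_one_sub_sum_of_factors k Finset.univ h (fun j => u j ≫ biprod.fst)
    (fun j => biprod.inl ≫ v j)
  have : 𝟙 Z - ∑ j, (u j ≫ biprod.fst) ≫ biprod.inl ≫ v j =
      ∑ j, (u j ≫ biprod.snd) ≫ biprod.inr ≫ v j := by
    rw [sub_eq_iff_eq_add, ← huv, ← Finset.sum_add_distrib]
    refine Finset.sum_congr rfl fun j _ => ?_
    have h1 : u j ≫ v j = u j ≫ (biprod.fst ≫ biprod.inl + biprod.snd ≫ biprod.inr) ≫ v j := by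
      rw [biprod.total, Category.id_comp]
    rw [h1, Preadditive.add_comp, Preadditive.comp_add, add_comm]
    simp only [Category.assoc]
  rw [this] at key
  exact key

end Add

/-! ## Maximal `d`-rigid objects and maximal `τ_d`-rigid pairs -/

section Main

variable {C : Type u} [Category.{v} C] [Preadditive C] [HasBinaryBiproducts C]
  [HasFiniteBiproducts C] [IsIdempotentComplete C]
  {S : C ≌ C} {T : C} [S.functor.Additive] {m : ℕ} {𝒜 : Angulation (m + 1) S}
  (k : Type w) [Field k] [Linear k C] [∀ X Y : C, Module.Finite k (X ⟶ Y)]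

/-- The `τ_d` conditions control only morphisms through `add (S T)`. Duality does the rest: the
composite `T_0 ⟶ X ⟶ S Y` is dual to maps `Y ⟶ S T_0 ⟶ S X`, which the first condition kills.
Therefore every `X ⟶ S Y` factors through `add (S T)`, and the second condition kills it. -/
theorem Angulation.IsClusterTilting.extVanishes_iff (hT : 𝒜.IsClusterTilting T)
    (c : CalabiYau k S) {X Y : C} (hX : NoSummand (S.functor.obj T) X)
    (hY : NoSummand (S.functor.obj T) Y) {M N : ModuleCat.{v} (End T)ᵐᵒᵖ}
    [Module.Finite (End T)ᵐᵒᵖ M] [Module.Finite (End T)ᵐᵒᵖ N]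
    (eM : M ≅ (preadditiveCoyonedaObj T).obj X) (eN : N ≅ (preadditiveCoyonedaObj T).obj Y) :
    ExtVanishes S X Y ↔ HomTauVanishes k (m + 1) M N ∧ HomTauVanishes k (m + 1) N M := by
  rw [hT.homTauVanishes_iff k hY eM eN, hT.homTauVanishes_iff k hX eN eM]
  constructor
  · intro h
    exact ⟨fun W _ f g => c.extVanishes_symm h _, fun W _ f g => h _⟩
  · rintro ⟨h1, h2⟩ f
    obtain ⟨T₁, T₀, U, a, t, c', -, hT₀, hU, -, -, hdesc, -⟩ := hT.exists_presentation X
    obtain ⟨g, rfl⟩ := hdesc f (c.comp_eq_zero t f fun x => by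
      rw [← S.functor.map_preimage x, ← S.functor.map_comp,
        h1 _ (hT₀.map S.functor) (S.functor.preimage x) (S.functor.map t), S.functor.map_zero])
    exact h2 U hU c' g

end Main

/-! ### Correspondence between objects of `C` and pairs of modules -/

section Pairs

variable {C : Type u} [Category.{v} C] [Preadditive C] [HasFiniteBiproducts C] {S : C ≌ C} {T : C}

theorem inAdd_congr {X X' Y Y' : C} (e : X ≅ X') (e' : Y ≅ Y') : InAdd X Y ↔ InAdd X' Y' :=
  ⟨fun h => (h.of_left_retract (Retract.ofIso e)).of_retract (Retract.ofIso e'.symm),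
    fun h => (h.of_left_retract (Retract.ofIso e.symm)).of_retract (Retract.ofIso e')⟩

theorem inAdd_equivalence_iff [S.functor.Additive] {X Y : C} :
    InAdd (S.functor.obj X) (S.functor.obj Y) ↔ InAdd X Y := by
  refine ⟨fun h => ?_, fun h => h.map S.functor⟩
  exact (inAdd_congr (S.unitIso.app X) (S.unitIso.app Y)).2 (h.map S.inverse)

theorem forall_eq_zero_iff {P N : ModuleCat.{v} (End T)ᵐᵒᵖ} {B Y : C} (hB : InAdd T B)
    (eP : P ≅ (preadditiveCoyonedaObj T).obj B) (eN : N ≅ (preadditiveCoyonedaObj T).obj Y) :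
    (∀ f : P ⟶ N, f = 0) ↔ ∀ f : B ⟶ Y, f = 0 := by
  constructor
  · intro h f
    have h1 := h (eP.hom ≫ (preadditiveCoyonedaObj T).map f ≫ eN.inv)
    refine hB.coyoneda_map_injective ?_
    have h2 := congrArg (fun t => eP.inv ≫ t ≫ eN.hom) h1
    simp only [Category.assoc, Iso.inv_hom_id_assoc, Iso.inv_hom_id, Category.comp_id, zero_comp,
      comp_zero] at h2
    rw [h2, Functor.map_zero]
  · intro h f
    obtain ⟨g, hg⟩ := hB.exists_coyoneda_map_eq (eP.inv ≫ f ≫ eN.hom)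
    rw [h g, Functor.map_zero] at hg
    have h2 := congrArg (fun t => eP.hom ≫ t ≫ eN.inv) hg
    simpa using h2.symm

variable [HasBinaryBiproducts C]

theorem IsRigid.nonempty_coyoneda_iso (hT : IsRigid S T) {X X' X'' : C} (e : X ≅ X' ⊞ X'')
    (h : InAdd (S.functor.obj T) X'') :
    Nonempty ((preadditiveCoyonedaObj T).obj X ≅ (preadditiveCoyonedaObj T).obj X') := by
  refine ⟨(preadditiveCoyonedaObj T).mapIso e ≪≫ ⟨(preadditiveCoyonedaObj T).map biprod.fst,
    (preadditiveCoyonedaObj T).map biprod.inl, ?_, ?_⟩⟩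
  · have h1 : (biprod.fst ≫ biprod.inl : X' ⊞ X'' ⟶ X' ⊞ X'') = 𝟙 _ - biprod.snd ≫ biprod.inr := by
      rw [← biprod.total, add_sub_cancel_right]
    rw [← Functor.map_comp, h1, Functor.map_sub, hT.coyoneda_map_eq_zero h, sub_zero,
      CategoryTheory.Functor.map_id]
  · rw [← Functor.map_comp, biprod.inl_fst, CategoryTheory.Functor.map_id]

theorem Angulation.IsClusterTilting.exists_noSummand (k : Type w) [Field k] [Linear k C]
    [IsIdempotentComplete C] {m : ℕ} {𝒜 : Angulation (m + 1) S} [∀ X Y : C, Module.Finite k (X ⟶ Y)]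
    (hT : 𝒜.IsClusterTilting T)
    {N : ModuleCat.{v} (End T)ᵐᵒᵖ} (hN : EssIm T N) :
    ∃ Y : C, NoSummand (S.functor.obj T) Y ∧ Nonempty (N ≅ (preadditiveCoyonedaObj T).obj Y) := by
  obtain ⟨Y, ⟨e⟩⟩ := hN
  obtain ⟨Y', Y'', ⟨e'⟩, h1, h2⟩ := exists_isDecomposition k S T Y
  obtain ⟨i⟩ := hT.1.nonempty_coyoneda_iso e' h2
  exact ⟨Y', h1, ⟨e.symm ≪≫ i⟩⟩

variable [S.functor.Additive]

theorem IsDecomposition.inAdd_inverse {X X' X'' : C} (h : IsDecomposition S T X X' X'') :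
    InAdd T (S.inverse.obj X'') :=
  inAdd_equivalence_iff.1 ((inAdd_congr (Iso.refl _) (S.counitIso.app X'')).2 h.mem_add)

variable [IsIdempotentComplete C] {m : ℕ} {𝒜 : Angulation (m + 1) S}

/-- The pair `(C(T, X'), C(T, B))` is a maximal `τ_d`-rigid pair if and only if `X' ⊞ S B` is maximal
`d`-rigid. -/
theorem Angulation.IsClusterTilting.isMaximalTauRigidPair_iff (k : Type w) [Field k]
    [Linear k C] [∀ X Y : C, Module.Finite k (X ⟶ Y)] (hT : 𝒜.IsClusterTilting T)
    (c : CalabiYau k S) (hrigid : ∀ X : C, Indecomposable X → IsRigid S X)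
    {X X' B : C} (e : X ≅ X' ⊞ S.functor.obj B) (hX' : NoSummand (S.functor.obj T) X')
    (hB : InAdd T B) {M P : ModuleCat.{v} (End T)ᵐᵒᵖ}
    (eM : M ≅ (preadditiveCoyonedaObj T).obj X') (eP : P ≅ (preadditiveCoyonedaObj T).obj B) :
    IsMaximalTauRigidPair k (m + 1) T M P ↔ IsMaximalRigid S X := by
  have hM : EssIm T M := ⟨X', ⟨eM.symm⟩⟩
  have hMfin := hM.finite k
  obtain ⟨eX⟩ := hT.1.nonempty_coyoneda_iso e (hB.map S.functor)
  have h₁ {Y : C} (hY : NoSummand (S.functor.obj T) Y) {N : ModuleCat.{v} (End T)ᵐᵒᵖ}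
      (eN : N ≅ (preadditiveCoyonedaObj T).obj Y) : InAdd M N ↔ InAdd X Y := by
    rw [inAdd_congr (eM ≪≫ eX.symm) eN, hT.inAdd_coyoneda_iff k hY]
  -- `Ext^d(X, Y)` splits into `Ext^d(X', Y)`, governed by the `τ_d` conditions, and `Ext^d(S B, Y)
  -- ≅ C(B, Y)`, governed by `Hom(P, N)`.
  have h₂ {Y : C} (hY : NoSummand (S.functor.obj T) Y) {N : ModuleCat.{v} (End T)ᵐᵒᵖ}
      [Module.Finite (End T)ᵐᵒᵖ N] (eN : N ≅ (preadditiveCoyonedaObj T).obj Y) :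
      (HomTauVanishes k (m + 1) M N ∧ HomTauVanishes k (m + 1) N M ∧ ∀ f : P ⟶ N, f = 0) ↔
        ExtVanishes S X Y := by
    rw [← and_assoc, ← hT.extVanishes_iff k c hX' hY eM eN, forall_eq_zero_iff hB eP eN,
      ← extVanishes_functor_obj_iff (S := S), ← extVanishes_biprod_left_iff]
    exact ⟨fun h => h.of_iso_left e.symm, fun h => h.of_iso_left e⟩
  have h₃ {A : C} (hA : InAdd T A) {Q : ModuleCat.{v} (End T)ᵐᵒᵖ}
      (eQ : Q ≅ (preadditiveCoyonedaObj T).obj A) :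
      InAdd P Q ↔ InAdd X (S.functor.obj A) := by
    rw [inAdd_congr eP eQ, inAdd_coyoneda_iff_of_inAdd hB hA, ← inAdd_equivalence_iff (S := S),
      inAdd_congr e (Iso.refl _)]
    refine ⟨fun h => h.of_left_retract (retractInr _ _), fun h => h.of_biprod k fun Z ⟨r⟩ h' => ?_⟩
    exact hX' Z ((hA.map S.functor).of_retract r) h'
  -- By symmetry the `X'` part is `Ext^d(S A, X') ≅ C(A, X')`; the `S B` part is `C(B, S A)`, which
  -- vanishes because `T` is rigid.
  have h₄ {A : C} (hA : InAdd T A) {Q : ModuleCat.{v} (End T)ᵐᵒᵖ}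
      (eQ : Q ≅ (preadditiveCoyonedaObj T).obj A) :
      (∀ f : Q ⟶ M, f = 0) ↔ ExtVanishes S X (S.functor.obj A) := by
    rw [forall_eq_zero_iff hA eQ eM, ← extVanishes_functor_obj_iff (S := S)]
    constructor
    · intro h
      refine ExtVanishes.of_iso_left (extVanishes_biprod_left_iff.2 ⟨c.extVanishes_symm h, ?_⟩)
        e.symm
      exact extVanishes_functor_obj_iff.2 fun f => hT.1.eq_zero hB (hA.map S.functor) f
    · intro h
      exact c.extVanishes_symm (extVanishes_biprod_left_iff.1 (h.of_iso_left e)).1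
  rw [c.isMaximalRigid_iff hrigid]
  constructor
  · intro h Y
    -- Both sides of the criterion are additive in `Y`, so it suffices to test `Y'` by condition (i)
    -- and `S A ≅ Y''` by condition (ii).
    obtain ⟨Y', Y'', ⟨e'⟩, hY', hY''⟩ := exists_isDecomposition k S T Y
    let A := S.inverse.obj Y''
    let i : S.functor.obj A ≅ Y'' := S.counitIso.app Y''
    have hA : InAdd T A := inAdd_equivalence_iff.1 ((inAdd_congr (Iso.refl _) i).2 hY'')
    have hN : EssIm T ((preadditiveCoyonedaObj T).obj Y') := ⟨Y', ⟨Iso.refl _⟩⟩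
    have := hN.finite k
    have k₁ : InAdd X Y' ↔ ExtVanishes S X Y' := by
      rw [← h₁ hY' (Iso.refl _), ← h₂ hY' (Iso.refl _)]
      exact h.inAdd_iff _ hN
    have k₂ : InAdd X (S.functor.obj A) ↔ ExtVanishes S X (S.functor.obj A) := by
      rw [← h₃ hA (Iso.refl _), ← h₄ hA (Iso.refl _)]
      exact h.inAdd_proj_iff _ hA.isFgProj
    let e'' : Y ≅ Y' ⊞ S.functor.obj A := e' ≪≫ biprod.mapIso (Iso.refl _) i.symm
    rw [inAdd_congr (Iso.refl X) e'', inAdd_biprod_iff, k₁, k₂]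
    constructor
    · intro h
      exact (c.extVanishes_biprod_right h.1 h.2).of_iso_right e''.symm
    · intro h
      have h' := h.of_iso_right e''
      exact ⟨h'.of_inAdd_right ((InAdd.refl _).of_retract (retractInl _ _)),
        h'.of_inAdd_right ((InAdd.refl _).of_retract (retractInr _ _))⟩
  · intro h
    refine ⟨hM, hB.isFgProj.of_iso eP.symm, fun N hN => ?_, fun Q hQ => ?_⟩
    · obtain ⟨Y, hY, ⟨eN⟩⟩ := hT.exists_noSummand k hN
      have := hN.finite k
      exact (h₁ hY eN).trans ((h Y).trans (h₂ hY eN).symm)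
    · obtain ⟨A, hA, ⟨eQ⟩⟩ := hQ.exists_iso
      exact (h₃ hA eQ).trans ((h _).trans (h₄ hA eQ).symm)

theorem Angulation.IsClusterTilting.maximalTauRigidPairs_iff (k : Type w) [Field k]
    [Linear k C] [∀ X Y : C, Module.Finite k (X ⟶ Y)] (hT : 𝒜.IsClusterTilting T)
    (c : CalabiYau k S) (hrigid : ∀ X : C, Indecomposable X → IsRigid S X)
    {X X' X'' : C} (h : IsDecomposition S T X X' X'') :
    MaximalTauRigidPairs k (m + 1) T ((preadditiveCoyonedaObj T).obj X',
      (preadditiveCoyonedaObj T).obj (S.inverse.obj X'')) ↔ IsMaximalRigid S X := by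
  obtain ⟨e⟩ := h.iso
  exact hT.isMaximalTauRigidPair_iff k c hrigid
    (e ≪≫ biprod.mapIso (Iso.refl _) (S.counitIso.app X'').symm) h.no_summand h.inAdd_inverse
    (Iso.refl _) (Iso.refl _)

end Pairs

/-! ### Equality of isomorphism classes -/

section Classes

variable {C : Type u} [Category.{v} C]

theorem IsoClasses.mk_eq_mk_iff {P : ObjectProperty C} {X Y : C} {hX : P X} {hY : P Y} :
    IsoClasses.mk P X hX = IsoClasses.mk P Y hY ↔ Nonempty (X ≅ Y) := by
  refine Iff.trans (Quotient.eq (r := isIsomorphicSetoid P.FullSubcategory)) ?_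
  exact ⟨fun ⟨e⟩ => ⟨P.ι.mapIso e⟩, fun ⟨e⟩ => ⟨P.isoMk e⟩⟩

end Classes

end HigherAngulated

/-! ### The bijection -/

open HigherAngulated

theorem theoremB {k : Type w} [Field k] [IsAlgClosed k]
    {C : Type u} [Category.{v} C] [Preadditive C] [Linear k C]
    [HasBinaryBiproducts C] [HasFiniteBiproducts C] [IsIdempotentComplete C]
    [∀ X Y : C, Module.Finite k (X ⟶ Y)]
    (d : ℕ) (hd : 1 ≤ d)
    (S : C ≌ C) [S.functor.Additive] [S.functor.Linear k]
    (𝒜 : HigherAngulated.Angulation d S)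
    (hCY : Nonempty (HigherAngulated.CalabiYau k S))
    (T : C) (hT : 𝒜.IsClusterTilting T)
    (hrigid : ∀ X : C, Indecomposable X → HigherAngulated.IsRigid S X) :
    (∀ X : C, ∃ X' X'' : C, HigherAngulated.IsDecomposition S T X X' X'') ∧
    ∃ δ : HigherAngulated.IsoClasses (HigherAngulated.IsMaximalRigid S) →
        HigherAngulated.IsoClasses (HigherAngulated.MaximalTauRigidPairs k d T),
      Function.Bijective δ ∧
      ∀ (X : C) (hX : HigherAngulated.IsMaximalRigid S X) (X' X'' : C),
        HigherAngulated.IsDecomposition S T X X' X'' →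
        ∃ hMP : HigherAngulated.MaximalTauRigidPairs k d T
            ((preadditiveCoyonedaObj T).obj X', (preadditiveCoyonedaObj T).obj (S.inverse.obj X'')),
          δ (HigherAngulated.IsoClasses.mk _ X hX) = HigherAngulated.IsoClasses.mk _ _ hMP := by
  refine ⟨exists_isDecomposition k S T, ?_⟩
  obtain ⟨m, rfl⟩ : ∃ m, d = m + 1 := ⟨d - 1, by omega⟩
  obtain ⟨c⟩ := hCY
  -- The map is defined by one chosen decomposition per object; uniqueness of decompositions up to
  -- isomorphism then gives its value on every other one.
  choose dec₁ dec₂ hdec using exists_isDecomposition k S T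
  let F := preadditiveCoyonedaObj T
  have hpair {X X' X'' : C} (hX : IsMaximalRigid S X) (h : IsDecomposition S T X X' X'') :
      MaximalTauRigidPairs k (m + 1) T (F.obj X', F.obj (S.inverse.obj X'')) :=
    (hT.maximalTauRigidPairs_iff k c hrigid h).2 hX
  have hiso {X Y X' X'' Y' Y'' : C} (h : IsDecomposition S T X X' X'')
      (h' : IsDecomposition S T Y Y' Y'') (e : X ≅ Y) :
      Nonempty ((F.obj X', F.obj (S.inverse.obj X'')) ≅ (F.obj Y', F.obj (S.inverse.obj Y''))) := by
    obtain ⟨⟨e₁⟩, ⟨e₂⟩⟩ := h.nonempty_iso k h' e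
    exact ⟨Iso.prod (F.mapIso e₁) (F.mapIso (S.inverse.mapIso e₂))⟩
  let δ : IsoClasses (IsMaximalRigid S) → IsoClasses (MaximalTauRigidPairs k (m + 1) T) :=
    Quotient.lift (fun X => IsoClasses.mk _ _ (hpair X.property (hdec X.obj))) (by
      rintro X Y ⟨e⟩
      exact IsoClasses.mk_eq_mk_iff.2 (hiso (hdec _) (hdec _) ((IsMaximalRigid S).ι.mapIso e)))
  have hδ (X : C) (hX : IsMaximalRigid S X) (X' X'' : C) (h : IsDecomposition S T X X' X'') :
      δ (IsoClasses.mk _ X hX) = IsoClasses.mk _ _ (hpair hX h) :=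
    IsoClasses.mk_eq_mk_iff.2 (hiso (hdec X) h (Iso.refl X))
  refine ⟨δ, ⟨?_, ?_⟩, fun X hX X' X'' h => ⟨hpair hX h, hδ X hX X' X'' h⟩⟩
  · intro a b
    refine Quotient.inductionOn₂ a b fun X Y h => ?_
    obtain ⟨i⟩ := IsoClasses.mk_eq_mk_iff.1 h
    -- `X'` is recovered from the first module because it has no summand in `add (S T)`, and `S⁻¹
    -- X''` from the second because it lies in `add T`.
    obtain ⟨e₁⟩ := hT.nonempty_iso k (hdec X.obj).no_summand (hdec Y.obj).no_summand
      ((CategoryTheory.Prod.fst _ _).mapIso i)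
    obtain ⟨e₂⟩ := nonempty_iso_of_inAdd (hdec X.obj).inAdd_inverse (hdec Y.obj).inAdd_inverse
      ((CategoryTheory.Prod.snd _ _).mapIso i)
    obtain ⟨a⟩ := (hdec X.obj).iso
    obtain ⟨b⟩ := (hdec Y.obj).iso
    exact IsoClasses.mk_eq_mk_iff.2 ⟨a ≪≫ biprod.mapIso e₁ ((S.counitIso.app _).symm ≪≫
      S.functor.mapIso e₂ ≪≫ S.counitIso.app _) ≪≫ b.symm⟩
  · intro b
    refine Quotient.inductionOn b fun ⟨⟨M, P⟩, hMP⟩ => ?_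
    obtain ⟨X', hX', ⟨eM⟩⟩ := hT.exists_noSummand k hMP.mem
    obtain ⟨B, hB, ⟨eP⟩⟩ := hMP.proj.exists_iso
    -- The preimage of `(M, P) ≅ (C(T, X'), C(T, B))` is `X' ⊞ S B`, which is already decomposed.
    have hX : IsMaximalRigid S (X' ⊞ S.functor.obj B) :=
      (hT.isMaximalTauRigidPair_iff k c hrigid (Iso.refl _) hX' hB eM eP).1 hMP
    refine ⟨IsoClasses.mk _ _ hX, (hδ _ hX X' _ ⟨⟨Iso.refl _⟩, hX', hB.map S.functor⟩).trans ?_⟩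
    exact IsoClasses.mk_eq_mk_iff.2 ⟨Iso.prod eM.symm (F.mapIso (S.unitIso.app B).symm ≪≫ eP.symm)⟩
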